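/- A trihedral solid angle with apex at the origin is a set of the form $A=\{t_1v_1+t_2v_2+t_3v_3 : t_1,t_2,t_3\ge 0\}\subset\mathbb R^3$ with $v_1,v_2,v_3\in\mathbb R^3$ linearly independent. Two such angles are congruent if a rotation in $SO(3)$ takes one to the other. Let $\mathcal A^3$ be the set of congruence classes of trihedral solid angles, with the quotient topology induced from the space of linearly independent triples $(v_1,v_2,v_3)$. A regular octahedron is inscribed into $\partial A$ if all six of its vertices lie on $\partial A$, where the octahedron may have any positive size and any position in $\mathbb R^3$. Let $\mathcal A^3_S\subset\mathcal A^3$ be the set of classes of those angles $A$ whose boundary $\partial A$ admits an inscribed regular octahedron. Then $\mathcal A^3\setminus\mathcal A^3_S$ is arcwise connected (path connected): it is non-empty, and any two of its points can be joined by a continuous path inside it. -/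

import Mathlib

open Set Topology

namespace OctahedronInscription

/-- Euclidean three-space. -/
abbrev E3 : Type := EuclideanSpace ℝ (Fin 3)

/-- A rotation of `ℝ³` about the origin, i.e. an element of `SO(3)`: a linear isometry of
determinant one. -/
def IsRotation (ρ : E3 ≃ₗᵢ[ℝ] E3) : Prop :=
  LinearMap.det (ρ.toLinearEquiv : E3 →ₗ[ℝ] E3) = 1

theorem isRotation_refl : IsRotation (LinearIsometryEquiv.refl ℝ E3) := by
  unfold IsRotation
  exact LinearMap.det_id

theorem IsRotation.trans {ρ σ : E3 ≃ₗᵢ[ℝ] E3} (hρ : IsRotation ρ) (hσ : IsRotation σ) :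
    IsRotation (ρ.trans σ) := by
  unfold IsRotation at *
  have h : ((ρ.trans σ).toLinearEquiv : E3 →ₗ[ℝ] E3)
      = (σ.toLinearEquiv : E3 →ₗ[ℝ] E3) ∘ₗ (ρ.toLinearEquiv : E3 →ₗ[ℝ] E3) := rfl
  rw [h, LinearMap.det_comp, hρ, hσ, one_mul]

theorem IsRotation.symm {ρ : E3 ≃ₗᵢ[ℝ] E3} (hρ : IsRotation ρ) : IsRotation ρ.symm := by
  unfold IsRotation at *
  have h : LinearMap.det (ρ.symm.toLinearEquiv : E3 →ₗ[ℝ] E3)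
      * LinearMap.det (ρ.toLinearEquiv : E3 →ₗ[ℝ] E3) = 1 :=
    LinearEquiv.det_symm_mul_det ρ.toLinearEquiv
  rwa [hρ, mul_one] at h

/-- The vertices of the standard regular octahedron: `e₀, e₁, e₂, -e₀, -e₁, -e₂`. -/
def octahedronVertices : Set E3 :=
  {x | ∃ i : Fin 3, x = EuclideanSpace.single i (1 : ℝ) ∨ x = -EuclideanSpace.single i (1 : ℝ)}

/-- `H` admits an inscribed regular octahedron: some image of the standard regular octahedron
under a similarity `x ↦ r • ρ x + c` of positive determinant has all its vertices on `H`. -/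
def AdmitsInscribedOctahedron (H : Set E3) : Prop :=
  ∃ (r : ℝ) (ρ : E3 ≃ₗᵢ[ℝ] E3) (c : E3), 0 < r ∧ IsRotation ρ ∧
    ∀ x ∈ octahedronVertices, r • ρ x + c ∈ H

/-- The convex cone with apex `0` spanned by three vectors. -/
def coneOf (v : Fin 3 → E3) : Set E3 :=
  {x | ∃ t : Fin 3 → ℝ, (∀ i, 0 ≤ t i) ∧ x = ∑ i, t i • v i}

/-- Triples of linearly independent vectors of `ℝ³`, with the subspace topology. -/
abbrev Frame : Type := {v : Fin 3 → E3 // LinearIndependent ℝ v}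

/-- A trihedral solid angle with apex at the origin: a subset of `ℝ³` which is the convex cone
spanned by some three linearly independent vectors. -/
@[ext]
structure TrihedralAngle : Type where
  carrier : Set E3
  exists_frame : ∃ v : Frame, carrier = coneOf v.1

namespace TrihedralAngle

/-- The trihedral angle whose three edges are spanned by the vectors of a frame. -/
def ofFrame (v : Frame) : TrihedralAngle := ⟨coneOf v.1, v, rfl⟩

/-- The topology on trihedral angles is the quotient topology from `Frame`: a trihedral angle
varies continuously with vectors spanning its edges. -/
instance : TopologicalSpace TrihedralAngle := TopologicalSpace.coinduced ofFrame inferInstance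

/-- Congruence: being in the same orbit of `SO(3)`. -/
instance congruence : Setoid TrihedralAngle where
  r A B := ∃ ρ : E3 ≃ₗᵢ[ℝ] E3, IsRotation ρ ∧ ρ '' A.carrier = B.carrier
  iseqv :=
    { refl := fun A => ⟨LinearIsometryEquiv.refl ℝ E3, isRotation_refl, by simp⟩
      symm := by
        rintro A B ⟨ρ, hρ, h⟩
        refine ⟨ρ.symm, hρ.symm, ?_⟩
        rw [← h, Set.image_image]
        simp
      trans := by
        rintro A B C ⟨ρ, hρ, h⟩ ⟨σ, hσ, h'⟩
        refine ⟨ρ.trans σ, hρ.trans hσ, ?_⟩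
        rw [← h', ← h, Set.image_image]
        rfl }

/-- A solid angle is special if its boundary admits an inscribed regular octahedron. -/
def IsSpecial (A : TrihedralAngle) : Prop :=
  AdmitsInscribedOctahedron (frontier A.carrier)

end TrihedralAngle

/-- The configuration space of congruence classes of trihedral solid angles, with the quotient
topology. -/
abbrev AngleSpace : Type := Quotient TrihedralAngle.congruence

/-- The subset of classes of special trihedral angles. -/
def specialAngles : Set AngleSpace :=
  {q | ∃ A : TrihedralAngle, A.IsSpecial ∧ Quotient.mk TrihedralAngle.congruence A = q}

end OctahedronInscription

/-! Everything is read off the Gram matrix of the three outward unit normals of the angle: units on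
the diagonal, inner products `x`, `y`, `z` off it.

Centre the octahedron, use its axes as coordinates and scale each normal so that its supporting
plane is at the right distance. Inscription then says that three vectors of the cube `[-1, 1]³`
touch all six facets. Linear independence leaves two contact patterns: the planes contain a face, an
edge and a vertex of the octahedron, or each contains an edge. The Gram matrix in the second pattern
also satisfies the inequalities of the first (`exists_isCovering_of_edges`). So the angle is special
exactly when `IsCovering` holds for some ordering of the normals: `isCoveringUnordered_of_admits`
gives necessity, and the explicit octahedron in `admits_of_isCoveringUnordered` gives sufficiency.

The criterion is monotone: if it holds for `(l x, l y, l z)` with `0 ≤ l ≤ 1`, it holds for `(x, y,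
z)` (`IsCovering.of_scaled`). Hence shrinking the inner products of a non-special angle to zero
keeps it non-special. The path ends at orthogonal normals, that is, at the octant, so every
non-special class is joined to the class of the octant. -/

namespace OctahedronInscription

open scoped RealInnerProductSpace

/-! ### The face-edge-vertex criterion. -/

/-- The relation on the Gram matrix of three outward normals which says that some regular
octahedron has a triangular face, an edge and a vertex on the respective supporting planes. The
arguments are the squared norms `A`, `B`, `C` and the inner products `p` of the first two, `q` of
the outer two and `r` of the last two normals. -/
def IsCovering (A B C p q r : ℝ) : Prop :=
  p ≤ 0 ∧ A * B ≤ 9 * p ^ 2 ∧ 0 ≤ p * q - A * r ∧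
    (A * B - p ^ 2) * (A * C - q ^ 2) ≤ 4 * (p * q - A * r) ^ 2 ∧
    √3 * √(A * (A * B * C + 2 * p * q * r - C * p ^ 2 - B * q ^ 2 - A * r ^ 2)) +
      2 * √2 * q * √(A * B - p ^ 2) ≤ p * q - A * r

/-- Each clause is homogeneous in each normal separately. This allows passing between unit normals
and the normals rescaled to the cube. -/
theorem IsCovering.smul {A B C p q r : ℝ} (h : IsCovering A B C p q r) {α β γ : ℝ}
    (hα : 0 < α) (hβ : 0 < β) (hγ : 0 < γ) :
    IsCovering (α * α * A) (β * β * B) (γ * γ * C) (α * β * p) (α * γ * q) (β * γ * r) := by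
  obtain ⟨h1, h2, h3, h4, h5⟩ := h
  have hK : α * β * p * (α * γ * q) - α * α * A * (β * γ * r)
      = α ^ 2 * β * γ * (p * q - A * r) := by ring
  refine ⟨?_, ?_, ?_, ?_, ?_⟩
  · have := mul_pos hα hβ
    nlinarith
  · have := mul_le_mul_of_nonneg_left h2 (sq_nonneg (α * β))
    linarith
  · rw [hK]; positivity
  · rw [hK]
    have := mul_le_mul_of_nonneg_left h4 (sq_nonneg (α ^ 2 * β * γ))
    linarith
  · rw [hK]
    have e1 : α * α * A * (α * α * A * (β * β * B) * (γ * γ * C)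
        + 2 * (α * β * p) * (α * γ * q) * (β * γ * r) - γ * γ * C * (α * β * p) ^ 2
        - β * β * B * (α * γ * q) ^ 2 - α * α * A * (β * γ * r) ^ 2)
        = (α ^ 2 * β * γ) ^ 2 *
          (A * (A * B * C + 2 * p * q * r - C * p ^ 2 - B * q ^ 2 - A * r ^ 2)) := by ring
    have e2 : α * α * A * (β * β * B) - (α * β * p) ^ 2 = (α * β) ^ 2 * (A * B - p ^ 2) := by ring
    rw [e1, e2, Real.sqrt_mul (sq_nonneg _), Real.sqrt_mul (sq_nonneg _),
      Real.sqrt_sq (by positivity), Real.sqrt_sq (by positivity)]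
    have := mul_le_mul_of_nonneg_left h5 (by positivity : 0 ≤ α ^ 2 * β * γ)
    linarith

/-- The arguments are the Gram entries of `(1, 1, 1)`, `(-1, -1, a)`, `(b, c, -1)`: planes through a
face, an edge and a vertex of the octahedron. After removing powers of `a + 1`, the fourth clause is
`0 ≤ (1 + b) * (1 + c)` and the last is `max b c ≤ 1`. -/
theorem isCovering_of_vertex_edge_face {a b c : ℝ} (ha : |a| ≤ 1) (hb : |b| ≤ 1) (hc : |c| ≤ 1) :
    IsCovering 3 (2 + a ^ 2) (1 + b ^ 2 + c ^ 2) (a - 2) (b + c - 1) (-(a + b + c)) := by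
  rw [abs_le] at ha hb hc
  obtain ⟨ha1, ha2⟩ := ha
  obtain ⟨hb1, hb2⟩ := hb
  obtain ⟨hc1, hc2⟩ := hc
  have hK : (a - 2) * (b + c - 1) - 3 * -(a + b + c) = (a + 1) * (b + c + 2) := by ring
  have ha : 0 ≤ a + 1 := by linarith
  have hbc : 0 ≤ b + c + 2 := by linarith
  refine ⟨by linarith, by nlinarith, ?_, ?_, ?_⟩
  · rw [hK]; positivity
  · rw [hK]
    have h : 0 ≤ (a + 1) ^ 2 * ((1 + b) * (1 + c)) :=
      mul_nonneg (sq_nonneg _) (mul_nonneg (by linarith) (by linarith))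
    nlinarith
  · rw [hK]
    have e1 : 3 * (3 * (2 + a ^ 2) * (1 + b ^ 2 + c ^ 2) + 2 * (a - 2) * (b + c - 1) * -(a + b + c)
        - (1 + b ^ 2 + c ^ 2) * (a - 2) ^ 2 - (2 + a ^ 2) * (b + c - 1) ^ 2
        - 3 * (-(a + b + c)) ^ 2) = 3 * ((a + 1) * (b - c)) ^ 2 := by ring
    have e2 : 3 * (2 + a ^ 2) - (a - 2) ^ 2 = 2 * (a + 1) ^ 2 := by ring
    rw [e1, e2, Real.sqrt_mul (by norm_num), Real.sqrt_mul (by norm_num), Real.sqrt_sq_eq_abs,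
      Real.sqrt_sq ha, abs_mul, abs_of_nonneg ha]
    have h3 : √3 * √3 = (3 : ℝ) := Real.mul_self_sqrt (by norm_num)
    have h2 : √2 * √2 = (2 : ℝ) := Real.mul_self_sqrt (by norm_num)
    have : |b - c| ≤ 2 - b - c := by rw [abs_le]; constructor <;> linarith
    have h := mul_le_mul_of_nonneg_left this ha
    have e3 : √3 * (√3 * ((a + 1) * |b - c|)) + 2 * √2 * (b + c - 1) * (√2 * (a + 1))
        = (√3 * √3) * ((a + 1) * |b - c|) + 2 * (√2 * √2) * (b + c - 1) * (a + 1) := by ring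
    rw [e3, h2, h3]
    linarith

/-! ### Three edge contacts reduce to the criterion. -/

/-- A polynomial of degree at most one in each of two variables which is nonnegative at the
vertices of a box is nonnegative on it. -/
theorem bilinear_nonneg {k l m n u v v₁ v₂ : ℝ} (hu : |u| ≤ 1) (h1 : v₁ ≤ v) (h2 : v ≤ v₂)
    (h₁ : 0 ≤ k + l + m * v₁ + n * v₁) (h₂ : 0 ≤ k + l + m * v₂ + n * v₂)
    (h₃ : 0 ≤ k - l + m * v₁ - n * v₁) (h₄ : 0 ≤ k - l + m * v₂ - n * v₂) :
    0 ≤ k + l * u + m * v + n * u * v := by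
  obtain ⟨hu1, hu2⟩ := abs_le.1 hu
  rcases h1.eq_or_lt with rfl | h1'
  · nlinarith
  have h : 0 < v₂ - v₁ := by linarith
  have a := mul_nonneg (mul_nonneg h₁ (by linarith : 0 ≤ 1 + u)) (sub_nonneg.2 h2)
  have b := mul_nonneg (mul_nonneg h₂ (by linarith : 0 ≤ 1 + u)) (sub_nonneg.2 h1)
  have c := mul_nonneg (mul_nonneg h₃ (by linarith : 0 ≤ 1 - u)) (sub_nonneg.2 h2)
  have d := mul_nonneg (mul_nonneg h₄ (by linarith : 0 ≤ 1 - u)) (sub_nonneg.2 h1)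
  refine nonneg_of_mul_nonneg_right (a := 2 * (v₂ - v₁)) ?_ (by linarith)
  linarith

/-- The normals are `(-t, -1, 1)`, `(1, -u, -1)`, `(-1, 1, -v)`, with determinant `-(t + u + v + t *
u * v)`. Replacing square roots by linear bounds leaves inequalities bilinear in `u`, `v` for fixed
`t`, to be checked at the corners of a rectangle. -/
theorem isCovering_of_edges_of_pos {t u v : ℝ} (ht0 : 0 ≤ t) (ht : t ≤ 1) (hu : |u| ≤ 1)
    (hv : |v| ≤ 1) (hut : u ≤ t) (hΔ : 0 ≤ t + u + v + t * u * v) :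
    IsCovering (2 + t ^ 2) (2 + u ^ 2) (2 + v ^ 2) (u - t - 1) (t - v - 1) (v - u - 1) := by
  obtain ⟨hu1, hu2⟩ := abs_le.1 hu
  obtain ⟨hv1, hv2⟩ := abs_le.1 hv
  have hu0 : 0 ≤ 1 + u := by linarith
  have h1t : 0 ≤ 1 - t := by linarith
  have htu : 0 ≤ 1 + t * u := by nlinarith
  have htv : 0 ≤ 1 + t * v := by nlinarith
  have ht2 : t ^ 2 ≤ 1 := by nlinarith
  have hu2' : u ^ 2 ≤ 1 := by nlinarith
  -- With normals `n₀`, `n₁`, `n₂`: `X` and `W` are the squared lengths of `n₀ × n₁` and `n₂ × n₀`,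
  -- and `K` is their inner product.
  set X : ℝ := (1 - t) ^ 2 + (1 + t * u) ^ 2 + (1 + u) ^ 2 with hX
  set W : ℝ := (1 + t * v) ^ 2 + (1 + t) ^ 2 + (1 - v) ^ 2 with hW
  set K : ℝ := (1 - t) * (1 + t * v) + (1 + t * u) * (1 + t) + (1 + u) * (1 - v) with hK
  have eK : (u - t - 1) * (t - v - 1) - (2 + t ^ 2) * (v - u - 1) = K := by rw [hK]; ring
  have eX : (2 + t ^ 2) * (2 + u ^ 2) - (u - t - 1) ^ 2 = X := by rw [hX]; ring
  have eW : (2 + t ^ 2) * (2 + v ^ 2) - (t - v - 1) ^ 2 = W := by rw [hW]; ring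
  have hK0 : 0 ≤ K :=
    add_nonneg (add_nonneg (mul_nonneg h1t htv) (mul_nonneg htu (by linarith)))
      (mul_nonneg hu0 (by linarith))
  have hX0 : 0 ≤ X := by positivity
  have hW0 : 0 ≤ W := by positivity
  -- The right side is the square of the sum of the three coordinates of the cross product; likewise
  -- for `W`.
  have sX : 2 * X ≤ (3 - t + u + t * u) ^ 2 := by
    have h : (1 - t) * (1 + u ^ 2) ≤ 2 * (2 + u + t * u) := by
      have h1 := mul_nonneg h1t (by linarith : 0 ≤ 1 - u ^ 2)
      have h2 := mul_nonneg (by linarith : 0 ≤ 1 + t) hu0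
      linarith
    have := mul_le_mul_of_nonneg_left h h1t
    rw [hX]; linarith only [this]
  have sW : 2 * W ≤ (3 + t + t * v - v) ^ 2 := by
    have h : (1 - t) ^ 2 * (1 - v) ≤ 4 * (1 + t * v) := by
      have h1 := mul_nonneg (by linarith : 0 ≤ 1 + t) (by linarith : 0 ≤ 1 + v)
      have h2 := mul_nonneg (mul_nonneg h1t (by linarith : 0 ≤ 1 + t)) (by linarith : 0 ≤ 1 - v)
      linarith
    have := mul_le_mul_of_nonneg_left h (by linarith : 0 ≤ 1 - v)
    rw [hW]; linarith only [this]
  refine ⟨by linarith, ?_, ?_, ?_, ?_⟩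
  · have h1 : (2 + t ^ 2) * (2 + u ^ 2) ≤ 3 * 3 :=
      mul_le_mul (by linarith only [ht2]) (by linarith only [hu2']) (by positivity) (by norm_num)
    have h2 : 1 ≤ (1 + t - u) ^ 2 := one_le_pow₀ (by linarith only [hut])
    linarith only [h1, h2]
  · rw [eK]; exact hK0
  · rw [eK, eX, eW]
    have hb : 0 ≤ (3 + t ^ 2) + (1 + 3 * t ^ 2) * u + -(1 + 3 * t ^ 2) * v
        + -(3 + t ^ 2) * u * v :=
      bilinear_nonneg hu hv1 hv2 (by linarith only [sq_nonneg t]) (by linarith only [ht2])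
        (by linarith only [ht2]) (by linarith only [ht2])
    have h : (3 - t + u + t * u) * (3 + t + t * v - v) ≤ 4 * K := by
      rw [hK]; linarith only [hb]
    have h0 : 0 ≤ (3 - t + u + t * u) * (3 + t + t * v - v) :=
      mul_nonneg (by linarith only [htu, hu0, h1t]) (by linarith only [htv, hv2, ht0])
    have h1 := mul_le_mul sX sW (by positivity) (sq_nonneg _)
    rw [← mul_pow] at h1
    have h2 := h1.trans (pow_le_pow_left₀ h0 h 2)
    linarith only [h2]
  -- Products of powers of `t` and `1 - t`, from which the corner values below are assembled.
  · have a0 : 0 ≤ 1 - t := h1t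
    have a1 := mul_nonneg a0 ht0
    have a2 := mul_nonneg a1 ht0
    have a3 := mul_nonneg a2 ht0
    have b0 := mul_nonneg a0 a0
    have b1 := mul_nonneg b0 ht0
    have b2 := mul_nonneg b1 ht0
    have c0 := mul_nonneg b0 a0
    have d0 := mul_nonneg c0 a0
    have h3 : √3 * √(2 + t ^ 2) ≤ (5 + t ^ 2) / 2 := by
      rw [← Real.sqrt_mul (by norm_num), Real.sqrt_le_left (by positivity)]
      linarith only [sq_nonneg (t ^ 2 - 1)]
    have eD : (2 + t ^ 2) * ((2 + t ^ 2) * (2 + u ^ 2) * (2 + v ^ 2)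
        + 2 * (u - t - 1) * (t - v - 1) * (v - u - 1) - (2 + v ^ 2) * (u - t - 1) ^ 2
        - (2 + u ^ 2) * (t - v - 1) ^ 2 - (2 + t ^ 2) * (v - u - 1) ^ 2)
        = (2 + t ^ 2) * (t + u + v + t * u * v) ^ 2 := by ring
    rw [eK, eX, eD, Real.sqrt_mul (by positivity), Real.sqrt_sq hΔ]
    have h3' := mul_le_mul_of_nonneg_right h3 hΔ
    have e2 : √2 * √X = √(2 * X) := (Real.sqrt_mul (by norm_num) _).symm
    -- The sign of the coefficient of `√2 * √X` decides whether a lower or an upper linear bound for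
    -- it is needed.
    rcases le_total (t - v - 1) 0 with hq | hq
    · have hs : 2 + u + t * u ≤ √2 * √X := by
        rw [e2]
        apply Real.le_sqrt_of_sq_le
        rw [hX]
        linarith only [sq_nonneg (1 - t), sq_nonneg ((1 - t) * u)]
      have h4 := mul_le_mul_of_nonpos_left hs hq
      have hb : 0 ≤ (14 - 13 * t - t ^ 3) + (1 + 2 * t - 3 * t ^ 2) * u
          + (1 + 2 * t - 3 * t ^ 2) * v + (2 - t - t ^ 3) * u * v :=
        bilinear_nonneg (v₁ := t - 1) hu (by linarith only [hq]) hv2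
          (by linarith only [a0, a1, a2, a3, b0, b1, b2, c0, d0])
          (by linarith only [a0, a1, a2, a3, b0, b1, b2, c0, d0])
          (by linarith only [a0, a1, a2, a3, b0, b1, b2, c0, d0])
          (by linarith only [a0, a1, a2, a3, b0, b1, b2, c0, d0])
      rw [hK]; linarith only [hb, h4, h3']
    · have hs : √2 * √X ≤ 3 - t + u + t * u := by
        rw [e2, Real.sqrt_le_left (by linarith only [htu, hu0, h1t])]
        exact sX
      have h4 := mul_le_mul_of_nonneg_left hs hq
      have hb : 0 ≤ (18 - 21 * t + 4 * t ^ 2 - t ^ 3) + (1 + 2 * t - 3 * t ^ 2) * u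
          + (5 - 2 * t - 3 * t ^ 2) * v + (2 - t - t ^ 3) * u * v :=
        bilinear_nonneg (v₂ := t - 1) hu hv1 (by linarith only [hq])
          (by linarith only [a0, a1, a2, a3, b0, b1, b2, c0, d0])
          (by linarith only [a0, a1, a2, a3, b0, b1, b2, c0, d0])
          (by linarith only [a0, a1, a2, a3, b0, b1, b2, c0, d0])
          (by linarith only [a0, a1, a2, a3, b0, b1, b2, c0, d0])
      rw [hK]; linarith only [hb, h4, h3']

/-- The relation `IsCovering` holds for some ordering of the three normals. -/
def IsCoveringUnordered (g : Fin 3 → Fin 3 → ℝ) : Prop :=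
  ∃ i j k : Fin 3, i ≠ j ∧ i ≠ k ∧ j ≠ k ∧
    IsCovering (g i i) (g j j) (g k k) (g i j) (g i k) (g j k)

/-- Cyclic symmetry makes `t` the largest parameter, and it is then nonnegative when the determinant
expression is positive. The substitution `(t, u, v) ↦ (-u, -t, -v)` swaps the first two normals and
reverses the sign of that expression. -/
theorem exists_isCovering_of_edges {t u v : ℝ} (ht : |t| ≤ 1) (hu : |u| ≤ 1) (hv : |v| ≤ 1)
    (hΔ : t + u + v + t * u * v ≠ 0) :
    IsCovering (2 + t ^ 2) (2 + u ^ 2) (2 + v ^ 2) (u - t - 1) (t - v - 1) (v - u - 1) ∨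
    IsCovering (2 + u ^ 2) (2 + v ^ 2) (2 + t ^ 2) (v - u - 1) (u - t - 1) (t - v - 1) ∨
    IsCovering (2 + v ^ 2) (2 + t ^ 2) (2 + u ^ 2) (t - v - 1) (v - u - 1) (u - t - 1) ∨
    IsCovering (2 + u ^ 2) (2 + t ^ 2) (2 + v ^ 2) (u - t - 1) (v - u - 1) (t - v - 1) ∨
    IsCovering (2 + t ^ 2) (2 + v ^ 2) (2 + u ^ 2) (t - v - 1) (u - t - 1) (v - u - 1) ∨
    IsCovering (2 + v ^ 2) (2 + u ^ 2) (2 + t ^ 2) (v - u - 1) (t - v - 1) (u - t - 1) := by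
  have key : ∀ {t u v : ℝ}, |t| ≤ 1 → |u| ≤ 1 → |v| ≤ 1 → 0 < t + u + v + t * u * v →
      IsCovering (2 + t ^ 2) (2 + u ^ 2) (2 + v ^ 2) (u - t - 1) (t - v - 1) (v - u - 1) ∨
      IsCovering (2 + u ^ 2) (2 + v ^ 2) (2 + t ^ 2) (v - u - 1) (u - t - 1) (t - v - 1) ∨
      IsCovering (2 + v ^ 2) (2 + t ^ 2) (2 + u ^ 2) (t - v - 1) (v - u - 1) (u - t - 1) := by
    intro t u v ht hu hv h
    have hmax : ∀ {t u v : ℝ}, |u| ≤ 1 → |v| ≤ 1 → 0 < t + u + v + t * u * v → u ≤ t → v ≤ t →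
        0 ≤ t := by
      intro t u v hu hv h hut hvt
      by_contra! ht
      obtain ⟨hu1, -⟩ := abs_le.1 hu
      obtain ⟨hv1, -⟩ := abs_le.1 hv
      have h1 : 0 < u * v := mul_pos_of_neg_of_neg (by linarith) (by linarith)
      nlinarith
    rcases le_total u t with hut | hut <;> rcases le_total v t with hvt | hvt <;>
      rcases le_total u v with huv | huv
    all_goals first
      | exact Or.inl (isCovering_of_edges_of_pos (hmax hu hv h (by linarith) (by linarith))
          (abs_le.1 ht).2 hu hv (by linarith) h.le)
      | exact Or.inr (Or.inl (isCovering_of_edges_of_pos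
          (hmax hv ht (by linarith) (by linarith) (by linarith))
          (abs_le.1 hu).2 hv ht (by linarith) (by linarith)))
      | exact Or.inr (Or.inr (isCovering_of_edges_of_pos
          (hmax ht hu (by linarith) (by linarith) (by linarith))
          (abs_le.1 hv).2 ht hu (by linarith) (by linarith)))
  rcases hΔ.lt_or_gt with h | h
  · have := key (t := -u) (u := -t) (v := -v) (by rwa [abs_neg]) (by rwa [abs_neg])
      (by rwa [abs_neg]) (by linarith)
    rw [neg_sq, neg_sq, neg_sq, show -t - -u - 1 = u - t - 1 by ring,
      show -u - -v - 1 = v - u - 1 by ring, show -v - -t - 1 = t - v - 1 by ring] at this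
    tauto
  · have := key ht hu hv h
    tauto

/-! ### Monotonicity under scaling of the inner products. -/

/-- The difference of the two sides is `(1 - l) * (1 + l - 2 * l ^ 2 * x * y * z)`. -/
theorem gramDet_smul_le {x y z l : ℝ} (hx : x ^ 2 ≤ 1) (hy : y ^ 2 ≤ 1) (hz : z ^ 2 ≤ 1)
    (h0 : 0 ≤ l) (h1 : l ≤ 1) :
    l ^ 2 * (1 + 2 * x * y * z - x ^ 2 - y ^ 2 - z ^ 2) ≤
      1 + 2 * (l * x) * (l * y) * (l * z) - (l * x) ^ 2 - (l * y) ^ 2 - (l * z) ^ 2 := by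
  have hw : x * y * z ≤ 1 := by
    apply le_of_abs_le
    rw [abs_mul, abs_mul]
    have hx := (sq_le_one_iff_abs_le_one x).1 hx
    have hy := (sq_le_one_iff_abs_le_one y).1 hy
    have hz := (sq_le_one_iff_abs_le_one z).1 hz
    exact mul_le_one₀ (mul_le_one₀ hx (abs_nonneg _) hy) (abs_nonneg _) hz
  have h2 : l ^ 2 * (x * y * z) ≤ l := by
    have := mul_le_mul_of_nonneg_left hw (sq_nonneg l)
    nlinarith
  have h3 : 0 ≤ (1 - l) * (1 + l - 2 * (l ^ 2 * (x * y * z))) :=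
    mul_nonneg (by linarith) (by linarith)
  linarith

theorem gramDet_smul_pos {x y z l : ℝ} (hx : x ^ 2 ≤ 1) (hy : y ^ 2 ≤ 1) (hz : z ^ 2 ≤ 1)
    (hD : 0 < 1 + 2 * x * y * z - x ^ 2 - y ^ 2 - z ^ 2) (h0 : 0 ≤ l) (h1 : l ≤ 1) :
    0 < 1 + 2 * (l * x) * (l * y) * (l * z) - (l * x) ^ 2 - (l * y) ^ 2 - (l * z) ^ 2 := by
  rcases h0.eq_or_lt with rfl | h0'
  · norm_num
  · exact (mul_pos (pow_pos h0' 2) hD).trans_le (gramDet_smul_le hx hy hz h0 h1)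

-- The sign of `y` decides how the last clause is transported. For `y ≥ 0`, divide it by `l` and
-- control the change of `√(1 - x ^ 2)`; for `y < 0`, compare the determinants after normalizing by
-- `s * ρ`.
set_option maxHeartbeats 1000000 in
theorem IsCovering.of_scaled {x y z l : ℝ} (hx : x ^ 2 < 1) (hy : y ^ 2 < 1) (hz : z ^ 2 < 1)
    (hD : 0 < 1 + 2 * x * y * z - x ^ 2 - y ^ 2 - z ^ 2) (h0 : 0 ≤ l) (h1 : l ≤ 1)
    (h : IsCovering 1 1 1 (l * x) (l * y) (l * z)) : IsCovering 1 1 1 x y z := by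
  have hDle := gramDet_smul_le hx.le hy.le hz.le h0 h1
  unfold IsCovering at h ⊢
  simp only [one_mul, mul_one] at h ⊢
  obtain ⟨h2, h3, h4, h5, h6⟩ := h
  have hl : 0 < l := by
    rcases h0.eq_or_lt with rfl | h0'
    · norm_num at h3
    · exact h0'
  have hl2 : l ^ 2 ≤ 1 := by nlinarith
  have hx0 : x ≤ 0 := by
    by_contra! hx0
    linarith [mul_pos hl hx0]
  have hx9 : 1 ≤ 9 * x ^ 2 := by nlinarith
  set D := 1 + 2 * x * y * z - x ^ 2 - y ^ 2 - z ^ 2 with hDdef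
  set D' := 1 + 2 * (l * x) * (l * y) * (l * z) - (l * x) ^ 2 - (l * y) ^ 2 - (l * z) ^ 2
    with hDdef'
  have hss : √(1 - x ^ 2) ≤ √(1 - (l * x) ^ 2) := Real.sqrt_le_sqrt (by
    rw [mul_pow]
    linarith only [mul_le_of_le_one_left (sq_nonneg x) hl2])
  have hDs : l * √D ≤ √D' := by
    apply Real.le_sqrt_of_sq_le
    rw [mul_pow, Real.sq_sqrt hD.le]
    exact hDle
  have hs0 : 0 < 1 - x ^ 2 := by linarith
  have hs0' : 0 < 1 - (l * x) ^ 2 := by nlinarith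
  have hr0 : 0 < 1 - y ^ 2 := by linarith
  have hr0' : 0 < 1 - (l * y) ^ 2 := by nlinarith
  have hs := Real.sq_sqrt hs0.le
  have hs' := Real.sq_sqrt hs0'.le
  have hsp := Real.sqrt_pos.2 hs0
  have hsp' := Real.sqrt_pos.2 hs0'
  have h2' : √2 ^ 2 = (2 : ℝ) := Real.sq_sqrt (by norm_num)
  have h2p : 0 < √(2 : ℝ) := by positivity
  have h3p : 0 < √(3 : ℝ) := by positivity
  set s := √(1 - x ^ 2)
  set s' := √(1 - (l * x) ^ 2)
  refine ⟨hx0, hx9, ?_⟩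
  rcases le_or_gt 0 y with hy0 | hy0
  · have key : √3 * √D + 2 * √2 * y * s ≤ x * y - z := by
      have a1 : √3 * √D + 2 * √2 * y * s' ≤ l * x * y - z := by
        refine le_of_mul_le_mul_left ?_ hl
        have := mul_le_mul_of_nonneg_left hDs h3p.le
        linarith
      have b1 : s' ≤ 2 * √2 * (l * -x) := by
        refine abs_le_of_sq_le_sq' ?_ ?_ |>.2
        · nlinarith
        · have : 0 ≤ l * -x := by linarith
          positivity
      have b2 : s ≤ 2 * √2 * -x := by
        refine abs_le_of_sq_le_sq' ?_ ?_ |>.2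
        · nlinarith
        · have : 0 ≤ -x := by linarith
          positivity
      -- Difference of squares: `(s' - s) * (s' + s) = x ^ 2 * (1 - l ^ 2)`, with `s' + s` bounded
      -- by `b1` and `b2`. This gain pays exactly for replacing `l * x * y` by `x * y`.
      have b3 : -x * (1 - l) ≤ 2 * √2 * (s' - s) := by
        refine le_of_mul_le_mul_right ?_ (add_pos hsp' hsp)
        have c1 : 2 * √2 * (s' - s) * (s' + s) = 2 * √2 * (x ^ 2 * (1 - l ^ 2)) := by
          linear_combination 2 * √2 * (hs' - hs)
        rw [c1]
        have := mul_le_mul_of_nonneg_left (add_le_add b1 b2)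
          (mul_nonneg (by linarith : 0 ≤ -x) (by linarith : 0 ≤ 1 - l))
        linarith
      have := mul_le_mul_of_nonneg_left b3 hy0
      linarith
    have hK : √3 * √D ≤ x * y - z := by
      have : 0 ≤ 2 * √2 * y * s := by positivity
      linarith
    have hK0 : 0 ≤ x * y - z := le_trans (by positivity) hK
    refine ⟨hK0, ?_, key⟩
    -- Squaring gives `3 * D ≤ (x * y - z) ^ 2`; since `D = (1 - x ^ 2) * (1 - y ^ 2) - (x * y - z)
    -- ^ 2`, the fourth clause follows.
    have := mul_self_le_mul_self (by positivity) hK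
    have e : √3 * √D * (√3 * √D) = 3 * D := by
      linear_combination √D ^ 2 * Real.sq_sqrt (by norm_num : (0 : ℝ) ≤ 3)
        + 3 * Real.sq_sqrt hD.le
    rw [e] at this
    nlinarith
  · have hxy : 0 ≤ x * y := mul_nonneg_of_nonpos_of_nonpos hx0 hy0.le
    have hK : l * x * (l * y) - l * z ≤ l * (x * y - z) := by
      have := mul_nonneg (mul_nonneg h0 (by linarith only [h1] : 0 ≤ 1 - l)) hxy
      linarith only [this]
    have hK0 : 0 ≤ x * y - z := nonneg_of_mul_nonneg_right (h4.trans hK) hl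
    have hKl : l * (x * y - z) ≤ x * y - z := mul_le_of_le_one_left hK0 h1
    have hprod : (1 - x ^ 2) * (1 - y ^ 2) ≤ (1 - (l * x) ^ 2) * (1 - (l * y) ^ 2) := by
      refine mul_le_mul ?_ ?_ hr0.le hs0'.le
      · rw [mul_pow]
        linarith only [mul_le_of_le_one_left (sq_nonneg x) hl2]
      · rw [mul_pow]
        linarith only [mul_le_of_le_one_left (sq_nonneg y) hl2]
    have eD : D = (1 - x ^ 2) * (1 - y ^ 2) - (x * y - z) ^ 2 := by rw [hDdef]; ring
    have eD' : D' = (1 - (l * x) ^ 2) * (1 - (l * y) ^ 2) - (l * x * (l * y) - l * z) ^ 2 := by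
      rw [hDdef']; ring
    have hrr : √(1 - y ^ 2) ≤ √(1 - (l * y) ^ 2) := Real.sqrt_le_sqrt (by
      rw [mul_pow]
      linarith only [mul_le_of_le_one_left (sq_nonneg y) hl2])
    have hD0' : 0 ≤ D' := le_trans (by positivity) hDle
    clear_value D D'
    set K := x * y - z
    set K' := l * x * (l * y) - l * z
    have hKK : K' ≤ K := hK.trans hKl
    have hsq : K' ^ 2 ≤ K ^ 2 := pow_le_pow_left₀ h4 hKK 2
    refine ⟨hK0, by linarith only [hprod, h5, hsq], ?_⟩
    have hr := Real.sq_sqrt hr0.le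
    have hr' := Real.sq_sqrt hr0'.le
    have hrp := Real.sqrt_pos.2 hr0
    have hrp' := Real.sqrt_pos.2 hr0'
    rw [← hs, ← hr] at eD
    rw [← hs', ← hr'] at eD'
    set ρ := √(1 - y ^ 2)
    set ρ' := √(1 - (l * y) ^ 2)
    have hsr : s * ρ ≤ s' * ρ' := mul_le_mul hss hrr hrp.le hsp'.le
    have hKsr : K' * (s * ρ) ≤ K * (s' * ρ') := mul_le_mul hKK hsr (by positivity) hK0
    -- Here `K / (s * ρ)` and `√D / (s * ρ)` are a cosine and a sine of one angle: as the cosine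
    -- grows with `l`, the sine falls.
    have hDD : √D * (s' * ρ') ≤ √D' * (s * ρ) := by
      refine abs_le_of_sq_le_sq' ?_ (by positivity) |>.2
      rw [mul_pow, mul_pow √D', Real.sq_sqrt hD.le, Real.sq_sqrt hD0', eD, eD']
      have := pow_le_pow_left₀ (by positivity) hKsr 2
      linarith only [this]
    have hA := mul_le_mul_of_nonneg_left hDD h3p.le
    have hB := mul_le_mul_of_nonneg_right h6 (by positivity : 0 ≤ s * ρ)
    have hC : (√3 * √D - K) * ρ' ≤ 2 * √2 * (l * -y) * (s * ρ) := by
      refine le_of_mul_le_mul_left ?_ hsp'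
      linarith only [hA, hB, hKsr]
    have hE : 2 * √2 * (l * -y) * (s * ρ) ≤ 2 * √2 * -y * s * ρ' := by
      have h8 : l * ρ ≤ ρ' := (mul_le_of_le_one_left hrp.le h1).trans hrr
      have h9 := mul_le_mul_of_nonneg_left h8
        (mul_nonneg (mul_nonneg (by positivity : 0 ≤ 2 * √2)
          (by linarith only [hy0] : 0 ≤ -y)) hsp.le)
      linarith only [h9]
    have hF := le_of_mul_le_mul_right (hC.trans hE) hrp'
    linarith only [hF]

/-! ### Contact patterns of three vectors in the cube. -/

theorem sum_fin_three_of_ne {i j k : Fin 3} (hij : i ≠ j) (hik : i ≠ k) (hjk : j ≠ k)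
    (f : Fin 3 → ℝ) : ∑ l, f l = f i + f j + f k := by
  have h : ∀ i j k : Fin 3, i ≠ j → i ≠ k → j ≠ k →
      (Finset.univ : Finset (Fin 3)) = {i, j, k} := by decide
  rw [h i j k hij hik hjk, Finset.sum_insert (by simp [hij, hik]), Finset.sum_pair hjk, add_assoc]

/-- The Gram determinant of three vectors, from their squared norms `A`, `B`, `C` and their inner
products `p`, `q`, `r`. -/
def gramDet (A B C p q r : ℝ) : ℝ :=
  A * B * C + 2 * p * q * r - C * p ^ 2 - B * q ^ 2 - A * r ^ 2

section

variable {n : Fin 3 → Fin 3 → ℝ}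

/-- Reflecting the coordinates by the signs `e₀`, `e₁`, `e₂` gives the normal form of
`isCovering_of_vertex_edge_face`. -/
theorem isCoveringUnordered_of_vertex (hn : ∀ k i, |n k i| ≤ 1) {k l m : Fin 3}
    (hkl : k ≠ l) (hkm : k ≠ m) (hlm : l ≠ m) {i₀ i₁ i₂ : Fin 3} (h01 : i₀ ≠ i₁) (h02 : i₀ ≠ i₂)
    (h12 : i₁ ≠ i₂) {e₀ e₁ e₂ : ℝ} (he₀ : |e₀| = 1) (he₁ : |e₁| = 1) (he₂ : |e₂| = 1)
    (hk₀ : n k i₀ = e₀) (hk₁ : n k i₁ = e₁) (hk₂ : n k i₂ = e₂) (hl₀ : n l i₀ = -e₀)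
    (hl₁ : n l i₁ = -e₁) (hm₂ : n m i₂ = -e₂) :
    IsCoveringUnordered fun k l => ∑ i, n k i * n l i := by
  refine ⟨k, l, m, hkl, hkm, hlm, ?_⟩
  have s₀ : e₀ ^ 2 = 1 := by rw [← sq_abs, he₀, one_pow]
  have s₁ : e₁ ^ 2 = 1 := by rw [← sq_abs, he₁, one_pow]
  have s₂ : e₂ ^ 2 = 1 := by rw [← sq_abs, he₂, one_pow]
  simp only [sum_fin_three_of_ne h01 h02 h12, hk₀, hk₁, hk₂, hl₀, hl₁, hm₂]
  have h := isCovering_of_vertex_edge_face (a := e₂ * n l i₂) (b := e₀ * n m i₀)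
    (c := e₁ * n m i₁) (by rw [abs_mul, he₂, one_mul]; exact hn _ _)
    (by rw [abs_mul, he₀, one_mul]; exact hn _ _) (by rw [abs_mul, he₁, one_mul]; exact hn _ _)
  convert h using 1
  · linear_combination s₀ + s₁ + s₂
  · linear_combination s₀ + s₁ - n l i₂ ^ 2 * s₂
  · linear_combination s₂ - n m i₀ ^ 2 * s₀ - n m i₁ ^ 2 * s₁
  · linear_combination -s₀ - s₁
  · linear_combination -s₂
  · ring

theorem isCoveringUnordered_of_matching (hn : ∀ k i, |n k i| ≤ 1)
    (hD : ∀ i j k : Fin 3, i ≠ j → i ≠ k → j ≠ k → gramDet (∑ l, n i l * n i l)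
      (∑ l, n j l * n j l) (∑ l, n k l * n k l) (∑ l, n i l * n j l) (∑ l, n i l * n k l)
      (∑ l, n j l * n k l) ≠ 0) {c₀ c₁ c₂ : Fin 3} (h01 : c₀ ≠ c₁) (h02 : c₀ ≠ c₂)
    (h12 : c₁ ≠ c₂) {e₀ e₁ e₂ : ℝ} (he₀ : |e₀| = 1) (he₁ : |e₁| = 1) (he₂ : |e₂| = 1)
    (h10 : n 1 c₀ = e₀) (h20 : n 2 c₀ = -e₀) (h21 : n 2 c₁ = e₁) (h01' : n 0 c₁ = -e₁)
    (h02' : n 0 c₂ = e₂) (h12' : n 1 c₂ = -e₂) :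
    IsCoveringUnordered fun k l => ∑ i, n k i * n l i := by
  have s₀ : e₀ ^ 2 = 1 := by rw [← sq_abs, he₀, one_pow]
  have s₁ : e₁ ^ 2 = 1 := by rw [← sq_abs, he₁, one_pow]
  have s₂ : e₂ ^ 2 = 1 := by rw [← sq_abs, he₂, one_pow]
  set t := -(e₀ * n 0 c₀) with ht
  set u := -(e₁ * n 1 c₁) with hu
  set v := -(e₂ * n 2 c₂) with hv
  have t1 : |t| ≤ 1 := by rw [ht, abs_neg, abs_mul, he₀, one_mul]; exact hn _ _
  have u1 : |u| ≤ 1 := by rw [hu, abs_neg, abs_mul, he₁, one_mul]; exact hn _ _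
  have v1 : |v| ≤ 1 := by rw [hv, abs_neg, abs_mul, he₂, one_mul]; exact hn _ _
  have hs : ∀ k l, ∑ i, n k i * n l i = n k c₀ * n l c₀ + n k c₁ * n l c₁ + n k c₂ * n l c₂ :=
    fun k l => sum_fin_three_of_ne h01 h02 h12 _
  have g00 : ∑ i, n 0 i * n 0 i = 2 + t ^ 2 := by
    rw [hs, h01', h02', ht]; linear_combination s₁ + s₂ - n 0 c₀ ^ 2 * s₀
  have g11 : ∑ i, n 1 i * n 1 i = 2 + u ^ 2 := by
    rw [hs, h10, h12', hu]; linear_combination s₀ + s₂ - n 1 c₁ ^ 2 * s₁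
  have g22 : ∑ i, n 2 i * n 2 i = 2 + v ^ 2 := by
    rw [hs, h20, h21, hv]; linear_combination s₀ + s₁ - n 2 c₂ ^ 2 * s₂
  have g01 : ∑ i, n 0 i * n 1 i = u - t - 1 := by
    rw [hs, h10, h12', h01', h02', hu, ht]; linear_combination -s₂
  have g12 : ∑ i, n 1 i * n 2 i = v - u - 1 := by
    rw [hs, h10, h12', h20, h21, hu, hv]; linear_combination -s₀
  have g02 : ∑ i, n 0 i * n 2 i = t - v - 1 := by
    rw [hs, h20, h21, h01', h02', hv, ht]; linear_combination -s₁
  have hsymm : ∀ k l, ∑ i, n k i * n l i = ∑ i, n l i * n k i := fun k l => by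
    simp only [mul_comm]
  have hΔ : t + u + v + t * u * v ≠ 0 := by
    intro h
    refine hD 0 1 2 (by decide) (by decide) (by decide) ?_
    rw [g00, g11, g22, g01, g02, g12, gramDet]
    linear_combination (t + u + v + t * u * v) * h
  rcases exists_isCovering_of_edges t1 u1 v1 hΔ with h | h | h | h | h | h
  · exact ⟨0, 1, 2, by decide, by decide, by decide, by simpa only [g00, g11, g22, g01, g02, g12]⟩
  · exact ⟨1, 2, 0, by decide, by decide, by decide, by
      simpa only [g00, g11, g22, hsymm 1 0, hsymm 2 0, g01, g02, g12]⟩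
  · exact ⟨2, 0, 1, by decide, by decide, by decide, by
      simpa only [g00, g11, g22, hsymm 2 1, hsymm 2 0, g01, g02, g12]⟩
  · exact ⟨1, 0, 2, by decide, by decide, by decide, by
      simpa only [g00, g11, g22, hsymm 1 0, g01, g02, g12]⟩
  · exact ⟨0, 2, 1, by decide, by decide, by decide, by
      simpa only [g00, g11, g22, hsymm 2 1, g01, g02, g12]⟩
  · exact ⟨2, 1, 0, by decide, by decide, by decide, by
      simpa only [g00, g11, g22, hsymm 1 0, hsymm 2 0, hsymm 2 1, g01, g02, g12]⟩

/-- If three vectors of the cube `[-1, 1]³` touch all of its six faces then their Gram matrix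
satisfies `IsCovering` in some order. -/
theorem isCoveringUnordered_of_cover (hn : ∀ k i, |n k i| ≤ 1)
    (hpos : ∀ i, ∃ k, n k i = 1) (hneg : ∀ i, ∃ k, n k i = -1)
    (hD : ∀ i j k : Fin 3, i ≠ j → i ≠ k → j ≠ k → gramDet (∑ l, n i l * n i l)
      (∑ l, n j l * n j l) (∑ l, n k l * n k l) (∑ l, n i l * n j l) (∑ l, n i l * n k l)
      (∑ l, n j l * n k l) ≠ 0) :
    IsCoveringUnordered fun k l => ∑ i, n k i * n l i := by
  -- In coordinate `i`, two vectors take opposite extreme values, and `w` is the remaining one.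
  -- Injective `w` is the three-edge pattern.
  have hcol : ∀ i, ∃ w : Fin 3, ∃ e : ℝ, |e| = 1 ∧ n (w + 1) i = e ∧ n (w + 2) i = -e := by
    intro i
    obtain ⟨k, hk⟩ := hpos i
    obtain ⟨l, hl⟩ := hneg i
    have hkl : k ≠ l := by
      rintro rfl
      linarith
    have key : ∀ k l : Fin 3, k ≠ l →
        (∃ w, w + 1 = k ∧ w + 2 = l) ∨ ∃ w, w + 1 = l ∧ w + 2 = k := by decide
    rcases key k l hkl with ⟨w, rfl, rfl⟩ | ⟨w, rfl, rfl⟩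
    · exact ⟨w, 1, abs_one, hk, hl⟩
    · exact ⟨w, -1, by simp, hl, by simpa using hk⟩
  choose w e he h1 h2 using hcol
  by_cases hw : Function.Injective w
  · have hsurj := Finite.surjective_of_injective hw
    obtain ⟨c₀, hc₀⟩ := hsurj 0
    obtain ⟨c₁, hc₁⟩ := hsurj 1
    obtain ⟨c₂, hc₂⟩ := hsurj 2
    have a₀ := h1 c₀
    have a₁ := h1 c₁
    have a₂ := h1 c₂
    have b₀ := h2 c₀
    have b₁ := h2 c₁
    have b₂ := h2 c₂
    rw [hc₀] at a₀ b₀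
    rw [hc₁] at a₁ b₁
    rw [hc₂] at a₂ b₂
    refine isCoveringUnordered_of_matching hn hD (c₀ := c₀) (c₁ := c₁) (c₂ := c₂) ?_ ?_ ?_
      (he c₀) (he c₁) (he c₂) a₀ b₀ a₁ b₁ a₂ b₂
    · rintro rfl; simp [hc₀] at hc₁
    · rintro rfl; simp [hc₀] at hc₂
    · rintro rfl; simp [hc₁] at hc₂
  · simp only [Function.Injective, not_forall] at hw
    obtain ⟨i, j, hwij, hij⟩ := hw
    obtain ⟨k, hik, hjk⟩ : ∃ k, i ≠ k ∧ j ≠ k := by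
      have h3 : ∀ i j : Fin 3, i ≠ j → ∃ k, i ≠ k ∧ j ≠ k := by decide
      exact h3 i j hij
    have hi1 := h1 i
    have hi2 := h2 i
    have hj1 := h1 j
    have hj2 := h2 j
    have hk1 := h1 k
    have hk2 := h2 k
    rw [hwij] at hi1 hi2
    have d12 : ∀ a : Fin 3, a + 1 ≠ a + 2 := by decide
    have d10 : ∀ a : Fin 3, a + 1 ≠ a := by decide
    have d20 : ∀ a : Fin 3, a + 2 ≠ a := by decide
    have cases3 : ∀ a b : Fin 3, b = a ∨ b = a + 1 ∨ b = a + 2 := by decide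
    have e11 : ∀ a : Fin 3, a + 1 + 1 = a + 2 := by decide
    have e12 : ∀ a : Fin 3, a + 1 + 2 = a := by decide
    have e21 : ∀ a : Fin 3, a + 2 + 1 = a := by decide
    have e22 : ∀ a : Fin 3, a + 2 + 2 = a + 1 := by decide
    rcases cases3 (w j) (w k) with h | h | h <;> rw [h] at hk1 hk2
    -- All three free entries lie in one row, so the other two vectors are opposite and the Gram
    -- determinant vanishes.
    · exfalso
      refine hD (w j + 1) (w j + 2) (w j) (d12 _) (d10 _) (d20 _) ?_
      simp only [sum_fin_three_of_ne hij hik hjk, hi1, hi2, hj1, hj2, hk1, hk2, gramDet]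
      ring
    · rw [e11] at hk1
      rw [e12] at hk2
      exact isCoveringUnordered_of_vertex hn (d12 _).symm (d20 _) (d10 _) hij hik hjk
        (by rw [abs_neg]; exact he i) (by rw [abs_neg]; exact he j) (he k) hi2 hj2 hk1
        (by rw [neg_neg]; exact hi1) (by rw [neg_neg]; exact hj1) hk2
    · rw [e21] at hk1
      rw [e22] at hk2
      exact isCoveringUnordered_of_vertex hn (d12 _) (d10 _) (d20 _) hij hik hjk
        (he i) (he j) (by rw [abs_neg]; exact he k) hi1 hj1 hk2 hi2 hj2
        (by rw [neg_neg]; exact hk1)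

end

/-! ### Trihedral cones, their normals and adapted coordinates. -/

/-- The cone of all points on the nonpositive side of three planes with given normals. -/
def halfspaceCone (N : Fin 3 → E3) : Set E3 := {x | ∀ k, ⟪N k, x⟫ ≤ 0}

theorem mem_frontier_halfspaceCone {N : Fin 3 → E3} (hN : ∀ k, N k ≠ 0) {x : E3} :
    x ∈ frontier (halfspaceCone N) ↔ (∀ k, ⟪N k, x⟫ ≤ 0) ∧ ∃ k, ⟪N k, x⟫ = 0 := by
  have hclosed : IsClosed (halfspaceCone N) := by
    simp only [halfspaceCone, ofPred_forall]
    exact isClosed_iInter fun k => isClosed_le (by fun_prop) continuous_const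
  rw [hclosed.frontier_eq, mem_sdiff]
  refine and_congr_right fun hx => ⟨fun hint => ?_, ?_⟩
  · by_contra! hne
    apply hint
    have hopen : IsOpen {x : E3 | ∀ k, ⟪N k, x⟫ < 0} := by
      simp only [ofPred_forall]
      exact isOpen_iInter_of_finite fun k => isOpen_lt (by fun_prop) continuous_const
    exact mem_interior.2 ⟨_, fun y hy k => (hy k).le, hopen, fun k => (hx k).lt_of_ne (hne k)⟩
  · rintro ⟨k, hk⟩ hint
    have hcont : Filter.Tendsto (fun t : ℝ => x + t • N k) (𝓝[>] 0) (𝓝 x) := by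
      have : Continuous fun t : ℝ => x + t • N k := by fun_prop
      simpa using (this.tendsto 0).mono_left nhdsWithin_le_nhds
    have hev := hcont.eventually (mem_interior_iff_mem_nhds.1 hint)
    obtain ⟨t, ht, ht0⟩ := (hev.and self_mem_nhdsWithin).exists
    have h1 := ht k
    rw [inner_add_right, hk, zero_add, real_inner_smul_right] at h1
    have h2 : 0 < ⟪N k, N k⟫ := real_inner_self_pos.2 (hN k)
    have : 0 < t * ⟪N k, N k⟫ := mul_pos ht0 h2
    linarith

theorem linearIndependent_of_dual {N v : Fin 3 → E3} (h : ∀ k l, k ≠ l → ⟪N l, v k⟫ = 0)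
    (h' : ∀ k, ⟪N k, v k⟫ ≠ 0) : LinearIndependent ℝ v := by
  rw [Fintype.linearIndependent_iff]
  intro g hg l
  have := congrArg (fun x => ⟪N l, x⟫) hg
  simp only [inner_sum, real_inner_smul_right, inner_zero_right] at this
  rw [Finset.sum_eq_single l (fun k _ hk => by rw [h k l hk, mul_zero]) (by simp)] at this
  exact (mul_eq_zero.1 this).resolve_right (h' l)

theorem coneOf_eq_halfspaceCone {N v : Fin 3 → E3} (h : ∀ k l, k ≠ l → ⟪N l, v k⟫ = 0)
    (h' : ∀ k, ⟪N k, v k⟫ < 0) : coneOf v = halfspaceCone N := by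
  have hli := linearIndependent_of_dual h fun k => (h' k).ne
  have hinner : ∀ (t : Fin 3 → ℝ) l, ⟪N l, ∑ i, t i • v i⟫ = t l * ⟪N l, v l⟫ := by
    intro t l
    simp only [inner_sum, real_inner_smul_right]
    exact Finset.sum_eq_single l (fun k _ hk => by rw [h k l hk, mul_zero]) (by simp)
  ext x
  constructor
  · rintro ⟨t, ht, rfl⟩ l
    rw [hinner]
    exact mul_nonpos_of_nonneg_of_nonpos (ht l) (h' l).le
  · intro hx
    have hx' : x ∈ Submodule.span ℝ (range v) := by
      rw [hli.span_eq_top_of_card_eq_finrank (by simp)]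
      exact Submodule.mem_top
    obtain ⟨t, rfl⟩ := (Submodule.mem_span_range_iff_exists_fun ℝ).1 hx'
    refine ⟨t, fun l => ?_, rfl⟩
    have := hx l
    rw [hinner] at this
    by_contra! htl
    linarith [mul_pos_of_neg_of_neg htl (h' l)]

theorem exists_unit_normals (v : Frame) : ∃ N : Fin 3 → E3, (∀ k, ‖N k‖ = 1) ∧
    LinearIndependent ℝ N ∧ coneOf v.1 = halfspaceCone N := by
  obtain ⟨v, hv⟩ := v
  let b : Module.Basis (Fin 3) ℝ E3 := basisOfLinearIndependentOfCardEqFinrank hv (by simp)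
  have hb : ∀ k, b k = v k := fun k => by simp [b]
  let w : Fin 3 → E3 := fun k =>
    (InnerProductSpace.toDual ℝ E3).symm (LinearMap.toContinuousLinearMap (b.coord k))
  have hw : ∀ k l, ⟪w l, v k⟫ = if k = l then 1 else 0 := by
    intro k l
    simp only [w, InnerProductSpace.toDual_symm_apply, ← hb]
    simp [Finsupp.single_apply]
  have hw0 : ∀ k, w k ≠ 0 := by
    intro k h0
    have := hw k k
    simp [h0] at this
  have hpos : ∀ k, 0 < ‖w k‖⁻¹ := fun k => inv_pos.2 (norm_pos_iff.2 (hw0 k))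
  have h1 : ∀ k l, k ≠ l → ⟪-(‖w l‖⁻¹ • w l), v k⟫ = 0 := by
    intro k l hkl
    simp [inner_neg_left, real_inner_smul_left, hw, hkl]
  have h2 : ∀ k, ⟪-(‖w k‖⁻¹ • w k), v k⟫ < 0 := by
    intro k
    simpa [inner_neg_left, real_inner_smul_left, hw] using hw0 k
  refine ⟨fun k => -(‖w k‖⁻¹ • w k), fun k => ?_, ?_, coneOf_eq_halfspaceCone h1 h2⟩
  · rw [norm_neg, norm_smul, norm_inv, norm_norm, inv_mul_cancel₀ (norm_ne_zero_iff.2 (hw0 k))]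
  · refine linearIndependent_of_dual (N := v) (fun k l hkl => ?_) fun k => ?_
    · rw [real_inner_comm]; exact h1 l k hkl.symm
    · rw [real_inner_comm]; exact (h2 k).ne

/-- The vector with given coordinates in an orthonormal basis of `ℝ³`. -/
noncomputable def comb (f : OrthonormalBasis (Fin 3) ℝ E3) (a b c : ℝ) : E3 :=
  a • f 0 + b • f 1 + c • f 2

theorem inner_comb (f : OrthonormalBasis (Fin 3) ℝ E3) (a b c a' b' c' : ℝ) :
    ⟪comb f a b c, comb f a' b' c'⟫ = a * a' + b * b' + c * c' := by
  have hf := orthonormal_iff_ite.1 f.orthonormal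
  simp only [comb, inner_add_left, inner_add_right, real_inner_smul_left, real_inner_smul_right, hf]
  simp only [Fin.reduceEq, ite_true, ite_false]
  ring

/-- Gram–Schmidt for three linearly independent unit vectors. -/
theorem exists_adapted_orthonormalBasis {N : Fin 3 → E3} (hN : ∀ k, ‖N k‖ = 1)
    (hli : LinearIndependent ℝ N) {i j k : Fin 3} (hij : i ≠ j) (hik : i ≠ k) (hjk : j ≠ k) :
    ∃ (f : OrthonormalBasis (Fin 3) ℝ E3) (x s y Y Z : ℝ), 0 < s ∧ 0 < Z ∧ x ^ 2 + s ^ 2 = 1 ∧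
      y ^ 2 + Y ^ 2 + Z ^ 2 = 1 ∧ N i = comb f 1 0 0 ∧ N j = comb f x s 0 ∧
      N k = comb f y Y Z := by
  have hN' : ∀ l, ⟪N l, N l⟫ = 1 := fun l => by rw [real_inner_self_eq_norm_sq, hN, one_pow]
  have hdep : ∀ a b c : ℝ, a • N i + b • N j + c • N k = 0 → b = 0 ∧ c = 0 := by
    intro a b c h
    have hinj : Function.Injective ![i, j, k] := by
      have : ∀ i j k : Fin 3, i ≠ j → i ≠ k → j ≠ k → Function.Injective ![i, j, k] := by decide
      exact this i j k hij hik hjk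
    have := (Fintype.linearIndependent_iff.1 (hli.comp _ hinj)) ![a, b, c]
      (by simpa [Fin.sum_univ_three] using h)
    exact ⟨by simpa using this 1, by simpa using this 2⟩
  set x := ⟪N i, N j⟫ with hx
  set y := ⟪N i, N k⟫ with hy
  have hs : N j - x • N i ≠ 0 := by
    intro h
    have := (hdep (-x) 1 0 (by rw [← h]; module)).1
    norm_num at this
  set s := ‖N j - x • N i‖ with hs'
  have hs0 : 0 < s := norm_pos_iff.2 hs
  set g := s⁻¹ • (N j - x • N i) with hg
  have hg1 : ‖g‖ = 1 := by
    rw [hg, norm_smul, norm_inv, norm_norm, inv_mul_cancel₀ hs0.ne']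
  have hgg : ⟪g, g⟫ = 1 := by rw [real_inner_self_eq_norm_sq, hg1, one_pow]
  have hig : ⟪N i, g⟫ = 0 := by
    rw [hg, real_inner_smul_right, inner_sub_right, real_inner_smul_right, hN', ← hx]
    ring
  have hj : N j = x • N i + s • g := by
    rw [hg, smul_smul, mul_inv_cancel₀ hs0.ne', one_smul]; abel
  have hgi : ⟪g, N i⟫ = 0 := by rw [real_inner_comm, hig]
  set Y := ⟪g, N k⟫ with hY
  have hZ : N k - y • N i - Y • g ≠ 0 := by
    intro h
    have := (hdep (-y + Y * s⁻¹ * x) (-(Y * s⁻¹)) 1 (by rw [← h, hg]; module)).2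
    norm_num at this
  set Z := ‖N k - y • N i - Y • g‖ with hZ'
  have hZ0 : 0 < Z := norm_pos_iff.2 hZ
  set e := Z⁻¹ • (N k - y • N i - Y • g) with he
  have he1 : ‖e‖ = 1 := by
    rw [he, norm_smul, norm_inv, norm_norm, inv_mul_cancel₀ hZ0.ne']
  have hee : ⟪e, e⟫ = 1 := by rw [real_inner_self_eq_norm_sq, he1, one_pow]
  have hie : ⟪N i, e⟫ = 0 := by
    rw [he, real_inner_smul_right, inner_sub_right, inner_sub_right, real_inner_smul_right,
      real_inner_smul_right, hN', hig, ← hy]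
    ring
  have hge : ⟪g, e⟫ = 0 := by
    rw [he, real_inner_smul_right, inner_sub_right, inner_sub_right, real_inner_smul_right,
      real_inner_smul_right, hgg, hgi, ← hY]
    ring
  have hei : ⟪e, N i⟫ = 0 := by rw [real_inner_comm, hie]
  have heg : ⟪e, g⟫ = 0 := by rw [real_inner_comm, hge]
  have hk : N k = y • N i + Y • g + Z • e := by
    rw [he, smul_smul Z, mul_inv_cancel₀ hZ0.ne', one_smul]; abel
  have hort : Orthonormal ℝ ![N i, g, e] := by
    rw [orthonormal_iff_ite]
    intro a b
    fin_cases a <;> fin_cases b <;>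
      simp [hN, hg1, he1, hig, hie, hge, hgi, hei, heg]
  let b := basisOfOrthonormalOfCardEqFinrank hort (by simp)
  let f : OrthonormalBasis (Fin 3) ℝ E3 := b.toOrthonormalBasis (by simpa [b] using hort)
  have hf0 : f 0 = N i := by simp [f, b]
  have hf1 : f 1 = g := by simp [f, b]
  have hf2 : f 2 = e := by simp [f, b]
  refine ⟨f, x, s, y, Y, Z, hs0, hZ0, ?_, ?_, ?_, ?_, ?_⟩
  · have := hN' j
    rw [hj] at this
    simp only [inner_add_left, inner_add_right, real_inner_smul_left, real_inner_smul_right, hN',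
      hgg, hig, hgi] at this
    linarith
  · have := hN' k
    rw [hk] at this
    simp only [inner_add_left, inner_add_right, real_inner_smul_left, real_inner_smul_right, hN',
      hgg, hig, hee, hie, hge, hgi, hei, heg] at this
    linarith
  · simp [comb, hf0]
  · rw [comb, hf0, hf1, zero_smul, add_zero, ← hj]
  · rw [comb, hf0, hf1, hf2, ← hk]

theorem gramDet_pos {N : Fin 3 → E3} (hN : ∀ k, ‖N k‖ = 1)
    (hli : LinearIndependent ℝ N) {i j k : Fin 3} (hij : i ≠ j) (hik : i ≠ k) (hjk : j ≠ k) :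
    0 < gramDet 1 1 1 ⟪N i, N j⟫ ⟪N i, N k⟫ ⟪N j, N k⟫ := by
  obtain ⟨f, x, s, y, Y, Z, hs, hZ, h1, h2, hi, hj, hk⟩ :=
    exists_adapted_orthonormalBasis hN hli hij hik hjk
  rw [hi, hj, hk, inner_comb, inner_comb, inner_comb, gramDet]
  have : 0 < (s * Z) ^ 2 := by positivity
  linear_combination this + (1 - y ^ 2) * h1 + s ^ 2 * h2

/-! ### Equivalence of inscription with the criterion. -/

/-- A regular octahedron inscribed in the boundary of a trihedral angle forces the relation
`IsCovering` between the outward unit normals of the angle, in some order. -/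
theorem isCoveringUnordered_of_admits {N : Fin 3 → E3} (hN : ∀ k, ‖N k‖ = 1)
    (hli : LinearIndependent ℝ N)
    (h : AdmitsInscribedOctahedron (frontier (halfspaceCone N))) :
    IsCoveringUnordered fun k l => ⟪N k, N l⟫ := by
  obtain ⟨r, ρ, c, hr, -, H⟩ := h
  have hN0 : ∀ k, N k ≠ 0 := fun k h0 => by simpa [h0] using hN k
  let b : OrthonormalBasis (Fin 3) ℝ E3 := (EuclideanSpace.basisFun (Fin 3) ℝ).map ρ
  have hb : ∀ i, ρ (EuclideanSpace.single i 1) = b i := fun i => by simp [b]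
  have Hpos : ∀ i, (∀ k, r * ⟪N k, b i⟫ + ⟪N k, c⟫ ≤ 0) ∧ ∃ k, r * ⟪N k, b i⟫ + ⟪N k, c⟫ = 0 := by
    intro i
    have := (mem_frontier_halfspaceCone hN0).1 (H (EuclideanSpace.single i 1) ⟨i, Or.inl rfl⟩)
    simpa only [hb, inner_add_right, real_inner_smul_right] using this
  have Hneg : ∀ i, (∀ k, -(r * ⟪N k, b i⟫) + ⟪N k, c⟫ ≤ 0) ∧
      ∃ k, -(r * ⟪N k, b i⟫) + ⟪N k, c⟫ = 0 := by
    intro i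
    have := (mem_frontier_halfspaceCone hN0).1 (H (-EuclideanSpace.single i 1) ⟨i, Or.inr rfl⟩)
    simpa only [map_neg, hb, inner_add_right, real_inner_smul_right, smul_neg, inner_neg_right]
      using this
  have hsum : ∀ k l, ∑ i, ⟪N k, b i⟫ * ⟪N l, b i⟫ = ⟪N k, N l⟫ := by
    intro k l
    rw [← b.sum_inner_mul_inner (N k) (N l)]
    exact Finset.sum_congr rfl fun i _ => by rw [real_inner_comm (b i) (N l)]
  -- Otherwise the antipodal vertices on each axis would force `N k` to be orthogonal to every `b
  -- i`.
  have hh : ∀ k, 0 < -⟪N k, c⟫ / r := by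
    intro k
    refine div_pos ?_ hr
    by_contra! hc
    have h0 : ∀ i, ⟪N k, b i⟫ = 0 := by
      intro i
      have h1 := (Hpos i).1 k
      have h2 := (Hneg i).1 k
      have : r * ⟪N k, b i⟫ = 0 := by linarith
      exact (mul_eq_zero.1 this).resolve_left hr.ne'
    have := hsum k k
    simp only [h0, mul_zero, Finset.sum_const_zero, real_inner_self_eq_norm_sq, hN] at this
    norm_num at this
  set t : Fin 3 → ℝ := fun k => -⟪N k, c⟫ / r with ht
  have htr : ∀ k, ⟪N k, c⟫ = -(r * t k) := fun k => by
    simp only [ht]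
    field_simp
  set n : Fin 3 → Fin 3 → ℝ := fun k i => ⟪N k, b i⟫ / t k with hn
  have htn : ∀ k i, ⟪N k, b i⟫ = t k * n k i := fun k i => by
    simp only [hn]
    rw [mul_div_cancel₀ _ (hh k).ne']
  have hg : ∀ k l, ⟪N k, N l⟫ = t k * t l * ∑ i, n k i * n l i := by
    intro k l
    rw [← hsum, Finset.mul_sum]
    exact Finset.sum_congr rfl fun i _ => by rw [htn, htn]; ring
  have hrt : ∀ k, 0 < r * t k := fun k => mul_pos hr (hh k)
  have hn1 : ∀ k i, |n k i| ≤ 1 := by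
    intro k i
    have h1 := (Hpos i).1 k
    have h2 := (Hneg i).1 k
    rw [htr, htn] at h1 h2
    rw [abs_le]
    constructor <;> refine le_of_mul_le_mul_left ?_ (hrt k) <;> linarith
  obtain ⟨i, j, k, hij, hik, hjk, hc⟩ := isCoveringUnordered_of_cover hn1
    (fun i => by
      obtain ⟨k, hk⟩ := (Hpos i).2
      rw [htr, htn] at hk
      refine ⟨k, mul_left_cancel₀ (hrt k).ne' ?_⟩
      linarith)
    (fun i => by
      obtain ⟨k, hk⟩ := (Hneg i).2
      rw [htr, htn] at hk
      refine ⟨k, mul_left_cancel₀ (hrt k).ne' ?_⟩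
      linarith)
    (fun i j k hij hik hjk h0 => by
      have hpos := gramDet_pos hN hli hij hik hjk
      have h1 : ∀ l, t l * t l * ∑ i, n l i * n l i = 1 := fun l => by
        rw [← hg, real_inner_self_eq_norm_sq, hN, one_pow]
      have e : gramDet 1 1 1 ⟪N i, N j⟫ ⟪N i, N k⟫ ⟪N j, N k⟫ = (t i * t j * t k) ^ 2 *
          gramDet (∑ l, n i l * n i l) (∑ l, n j l * n j l) (∑ l, n k l * n k l)
            (∑ l, n i l * n j l) (∑ l, n i l * n k l) (∑ l, n j l * n k l) := by
        have e1 : gramDet 1 1 1 ⟪N i, N j⟫ ⟪N i, N k⟫ ⟪N j, N k⟫ = gramDet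
            (t i * t i * ∑ l, n i l * n i l) (t j * t j * ∑ l, n j l * n j l)
            (t k * t k * ∑ l, n k l * n k l) ⟪N i, N j⟫ ⟪N i, N k⟫ ⟪N j, N k⟫ := by
          rw [h1, h1, h1]
        rw [e1, hg i j, hg i k, hg j k]
        simp only [gramDet]
        ring
      rw [e, h0, mul_zero] at hpos
      exact lt_irrefl _ hpos)
  refine ⟨i, j, k, hij, hik, hjk, ?_⟩
  simp only [hg]
  exact hc.smul (hh i) (hh j) (hh k)

theorem exists_isRotation_of_isometry (ρ : E3 ≃ₗᵢ[ℝ] E3) :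
    ∃ σ : E3 ≃ₗᵢ[ℝ] E3, IsRotation σ ∧ ((∀ x, σ x = ρ x) ∨ ∀ x, σ x = -ρ x) := by
  have habs : |LinearMap.det (ρ.toLinearEquiv : E3 →ₗ[ℝ] E3)| = 1 := by
    rw [← LinearMap.normDet_eq_abs_det]
    exact ρ.toLinearIsometry.normDet_eq_one
  rcases (abs_eq zero_le_one).1 habs with h | h
  · exact ⟨ρ, h, Or.inl fun _ => rfl⟩
  · refine ⟨ρ.trans (LinearIsometryEquiv.neg ℝ), ?_, Or.inr fun _ => rfl⟩
    have e : ((ρ.trans (LinearIsometryEquiv.neg ℝ)).toLinearEquiv : E3 →ₗ[ℝ] E3)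
        = (-1 : ℝ) • (ρ.toLinearEquiv : E3 →ₗ[ℝ] E3) := by
      ext1 x
      simp
    rw [IsRotation, e, LinearMap.det_smul, h, finrank_euclideanSpace_fin]
    norm_num

/-- Orientation is immaterial: the octahedron is centrally symmetric, and `-1` has determinant `-1`
in dimension three. -/
theorem admits_of_isometry {H : Set E3} {r : ℝ} (hr : 0 < r) (ρ : E3 ≃ₗᵢ[ℝ] E3) (c : E3)
    (h : ∀ x ∈ octahedronVertices, r • ρ x + c ∈ H) : AdmitsInscribedOctahedron H := by
  obtain ⟨σ, hσ, h' | h'⟩ := exists_isRotation_of_isometry ρ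
  · exact ⟨r, σ, c, hr, hσ, fun x hx => by rw [h']; exact h x hx⟩
  · refine ⟨r, σ, c, hr, hσ, fun x hx => ?_⟩
    rw [h', ← map_neg]
    refine h (-x) ?_
    obtain ⟨i, rfl | rfl⟩ := hx
    · exact ⟨i, Or.inr rfl⟩
    · exact ⟨i, Or.inl (neg_neg _)⟩

/-- In adapted coordinates the clauses become linear. The three bounds keep, in the construction
below, `u 2` on the right side of plane `j`, then `-u 0`, `-u 1` and finally `u 0`, `u 1` on the
right side of plane `k`. -/
theorem IsCovering.bounds {x s y Y Z : ℝ} (hs : 0 < s) (hZ : 0 < Z) (h1 : x ^ 2 + s ^ 2 = 1)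
    (h2 : y ^ 2 + Y ^ 2 + Z ^ 2 = 1) (h : IsCovering 1 1 1 x y (x * y + s * Y)) :
    s ≤ 2 * √2 * -x ∧ √3 * Z ≤ -3 * Y ∧ 2 * √2 * y + Y + √3 * Z ≤ 0 := by
  obtain ⟨hx, hx9, hK, hC1, hC2⟩ := h
  have eK : x * y - 1 * (x * y + s * Y) = s * -Y := by ring
  have es : (1 : ℝ) * 1 - x ^ 2 = s ^ 2 := by linarith
  have eD : 1 * (1 * 1 * 1 + 2 * x * y * (x * y + s * Y) - 1 * x ^ 2 - 1 * y ^ 2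
      - 1 * (x * y + s * Y) ^ 2) = (s * Z) ^ 2 := by
    linear_combination (y ^ 2 - 1) * h1 - s ^ 2 * h2
  rw [eK] at hK hC1 hC2
  rw [es] at hC1 hC2
  rw [eD, Real.sqrt_sq (by positivity), Real.sqrt_sq hs.le] at hC2
  have hY : 0 ≤ -Y := nonneg_of_mul_nonneg_right hK hs
  have s2 : √2 ^ 2 = (2 : ℝ) := Real.sq_sqrt (by norm_num)
  have s3 : √3 ^ 2 = (3 : ℝ) := Real.sq_sqrt (by norm_num)
  refine ⟨?_, ?_, ?_⟩
  · refine abs_le_of_sq_le_sq' ?_ (mul_nonneg (by positivity) (by linarith)) |>.2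
    rw [mul_pow, mul_pow, s2]
    linarith
  · refine abs_le_of_sq_le_sq' ?_ (by linarith) |>.2
    rw [mul_pow, s3]
    have : Z ^ 2 ≤ 3 * Y ^ 2 := by
      refine le_of_mul_le_mul_left ?_ (by positivity : 0 < s ^ 2)
      have : 1 * 1 - y ^ 2 = Y ^ 2 + Z ^ 2 := by linarith
      rw [this] at hC1
      linarith
    linarith
  · have : s * (2 * √2 * y + √3 * Z) ≤ s * -Y := by linarith
    linarith [le_of_mul_le_mul_left this hs]

theorem admits_of_isCoveringUnordered {N : Fin 3 → E3} (hN : ∀ k, ‖N k‖ = 1)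
    (hli : LinearIndependent ℝ N) (h : IsCoveringUnordered fun k l => ⟪N k, N l⟫) :
    AdmitsInscribedOctahedron (frontier (halfspaceCone N)) := by
  obtain ⟨i, j, k, hij, hik, hjk, hc⟩ := h
  have hN0 : ∀ k, N k ≠ 0 := fun k h0 => by simpa [h0] using hN k
  obtain ⟨f, x, s, y, Y, Z, hs, hZ, h1, h2, hi, hj, hk⟩ :=
    exists_adapted_orthonormalBasis hN hli hij hik hjk
  have s2 : √2 * √2 = (2 : ℝ) := Real.mul_self_sqrt (by norm_num)
  have s3 : √3 * √3 = (3 : ℝ) := Real.mul_self_sqrt (by norm_num)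
  have s6 : √6 * √6 = (6 : ℝ) := Real.mul_self_sqrt (by norm_num)
  have s6p : 0 < (√6 : ℝ) := by positivity
  have hb : s ≤ 2 * √2 * -x ∧ √3 * Z ≤ -3 * Y ∧ 2 * √2 * y + Y + √3 * Z ≤ 0 := by
    refine IsCovering.bounds hs hZ h1 h2 ?_
    simp only [real_inner_self_eq_norm_sq, hN, one_pow] at hc
    convert hc using 1
    · rw [hi, hj, inner_comb]; ring
    · rw [hi, hk, inner_comb]; ring
    · rw [hj, hk, inner_comb]; ring
  obtain ⟨b1, b2, b3⟩ := hb
  -- Orthogonal semi-axes of length `√6`, with equal component `√2` along `N i` and with `u 0 - u 1`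
  -- along the common line of planes `i` and `j`.
  set u : Fin 3 → E3 := fun a => comb f √2 (![-1, -1, 2] a) (![√3, -√3, 0] a) with hu
  have hu_inner : ∀ a b, ⟪u a, u b⟫ = if a = b then 6 else 0 := by
    intro a b
    rw [hu, inner_comb, s2]
    fin_cases a <;> fin_cases b <;> norm_num [s3]
  have hort : Orthonormal ℝ fun a => (√6)⁻¹ • u a := by
    rw [orthonormal_iff_ite]
    intro a b
    rw [real_inner_smul_left, real_inner_smul_right, hu_inner]
    split_ifs
    · field_simp
      linarith
    · simp
  let b := basisOfOrthonormalOfCardEqFinrank hort (by simp)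
  let g : OrthonormalBasis (Fin 3) ℝ E3 := b.toOrthonormalBasis (by simpa [b] using hort)
  have hg : ∀ a, √6 • g a = u a := fun a => by simp [g, b, smul_smul]
  let ρ : E3 ≃ₗᵢ[ℝ] E3 := (EuclideanSpace.basisFun (Fin 3) ℝ).equiv g (Equiv.refl _)
  have hρ : ∀ a, √6 • ρ (EuclideanSpace.single a 1) = u a := by
    intro a
    rw [← hg, ← EuclideanSpace.basisFun_apply, OrthonormalBasis.equiv_apply_basis]
    rfl
  -- The centre is chosen so that all `c + u a` lie on plane `i`, `c - u 0` and `c - u 1` on plane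
  -- `j`, and `c - u 2` on plane `k`.
  set c0 : ℝ := -√2
  set c1 : ℝ := (-(s - √2 * x) - x * c0) / s with hc1
  set c2 : ℝ := (√2 * y + 2 * Y - y * c0 - Y * c1) / Z with hc2
  set c : E3 := comb f c0 c1 c2 with hcdef
  have ci : ⟪N i, c⟫ = -√2 := by
    rw [hi, hcdef, inner_comb]
    ring
  have cj : ⟪N j, c⟫ = -(s - √2 * x) := by
    rw [hj, hcdef, inner_comb, hc1, mul_div_cancel₀ _ hs.ne']
    ring
  have ck : ⟪N k, c⟫ = √2 * y + 2 * Y := by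
    rw [hk, hcdef, inner_comb, hc2, mul_div_cancel₀ _ hZ.ne']
    ring
  have hall : ∀ l : Fin 3, l = i ∨ l = j ∨ l = k := by
    have : ∀ i j k : Fin 3, i ≠ j → i ≠ k → j ≠ k → ∀ l, l = i ∨ l = j ∨ l = k := by decide
    exact this i j k hij hik hjk
  have ui : ∀ a, ⟪N i, u a⟫ = √2 := by
    intro a
    rw [hi, hu, inner_comb]
    ring
  have uj : ∀ a, ⟪N j, u a⟫ = √2 * x + s * ![-1, -1, 2] a := by
    intro a
    rw [hj, hu, inner_comb]
    ring
  have uk : ∀ a, ⟪N k, u a⟫ = √2 * y + Y * ![-1, -1, 2] a + Z * ![√3, -√3, 0] a := by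
    intro a
    rw [hk, hu, inner_comb]
    ring
  have z3 : 0 < √3 * Z := by positivity
  have z2 : 0 < √2 := by positivity
  refine admits_of_isometry s6p ρ c ?_
  rintro _ ⟨a, rfl | rfl⟩
  · rw [hρ, mem_frontier_halfspaceCone hN0]
    simp only [inner_add_right]
    refine ⟨fun l => ?_, i, by rw [ui, ci]; ring⟩
    rcases hall l with rfl | rfl | rfl
    · rw [ui, ci]; linarith
    · rw [uj, cj]; fin_cases a <;> simp <;> linarith
    · rw [uk, ck]; fin_cases a <;> simp <;> linarith
  · rw [map_neg, smul_neg, hρ, mem_frontier_halfspaceCone hN0]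
    simp only [inner_add_right, inner_neg_right]
    refine ⟨fun l => ?_, ?_⟩
    · rcases hall l with rfl | rfl | rfl
      · rw [ui, ci]; linarith
      · rw [uj, cj]; fin_cases a <;> simp <;> linarith
      · rw [uk, ck]; fin_cases a <;> simp <;> linarith
    · fin_cases a
      · exact ⟨j, by rw [uj, cj]; simp; ring⟩
      · exact ⟨j, by rw [uj, cj]; simp; ring⟩
      · exact ⟨k, by rw [uk, ck]; simp; ring⟩

theorem inner_sq_lt_one {N : Fin 3 → E3} (hN : ∀ k, ‖N k‖ = 1)
    (hli : LinearIndependent ℝ N) {i j k : Fin 3} (hij : i ≠ j) (hik : i ≠ k) (hjk : j ≠ k) :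
    ⟪N i, N j⟫ ^ 2 < 1 := by
  obtain ⟨f, x, s, y, Y, Z, hs, -, h1, -, hi, hj, -⟩ :=
    exists_adapted_orthonormalBasis hN hli hij hik hjk
  rw [hi, hj, inner_comb]
  have : 0 < s ^ 2 := by positivity
  linarith

/-- Scaling down the inner products of the outward unit normals of a non-special angle gives a
non-special angle. -/
theorem not_admits_of_scaled {N M : Fin 3 → E3} (hN : ∀ k, ‖N k‖ = 1)
    (hNli : LinearIndependent ℝ N) (hM : ∀ k, ‖M k‖ = 1) (hMli : LinearIndependent ℝ M) {l : ℝ}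
    (h0 : 0 ≤ l) (h1 : l ≤ 1) (hinner : ∀ i j, i ≠ j → ⟪M i, M j⟫ = l * ⟪N i, N j⟫)
    (h : ¬ AdmitsInscribedOctahedron (frontier (halfspaceCone N))) :
    ¬ AdmitsInscribedOctahedron (frontier (halfspaceCone M)) := by
  intro hadm
  obtain ⟨i, j, k, hij, hik, hjk, hc⟩ := isCoveringUnordered_of_admits hM hMli hadm
  refine h (admits_of_isCoveringUnordered hN hNli ⟨i, j, k, hij, hik, hjk, ?_⟩)
  simp only [real_inner_self_eq_norm_sq, hM, hN, one_pow, hinner i j hij, hinner i k hik,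
    hinner j k hjk] at hc ⊢
  refine hc.of_scaled (inner_sq_lt_one hN hNli hij hik hjk)
    (inner_sq_lt_one hN hNli hik hij hjk.symm)
    (inner_sq_lt_one hN hNli hjk hij.symm hik.symm) ?_ h0 h1
  have := gramDet_pos hN hNli hij hik hjk
  simpa only [gramDet, one_mul, mul_one] using this

/-! ### Edges as continuous functions of triangular normals. -/

section Triangular

/-- Three vectors with a lower triangular coordinate matrix. -/
noncomputable def triangularNormals (f : OrthonormalBasis (Fin 3) ℝ E3) (x s y Y Z : ℝ) :
    Fin 3 → E3 :=
  ![comb f 1 0 0, comb f x s 0, comb f y Y Z]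

/-- The edges of the trihedral angle with outward normals `triangularNormals f x s y Y Z`. -/
noncomputable def triangularEdges (f : OrthonormalBasis (Fin 3) ℝ E3) (x s y Y Z : ℝ) :
    Fin 3 → E3 :=
  ![comb f (-(s * Z)) (x * Z) (s * y - x * Y), comb f 0 (-Z) Y, comb f 0 0 (-1)]

variable (f : OrthonormalBasis (Fin 3) ℝ E3) {x s y Y Z : ℝ}

theorem inner_triangular_of_ne (k l : Fin 3) (hkl : k ≠ l) :
    ⟪triangularNormals f x s y Y Z l, triangularEdges f x s y Y Z k⟫ = 0 := by
  fin_cases k <;> fin_cases l <;> first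
    | exact absurd rfl hkl
    | (simp [triangularNormals, triangularEdges, inner_comb]; try ring)

theorem inner_triangular_neg (hs : 0 < s) (hZ : 0 < Z) (k : Fin 3) :
    ⟪triangularNormals f x s y Y Z k, triangularEdges f x s y Y Z k⟫ < 0 := by
  have := mul_pos hs hZ
  fin_cases k <;> simpa [triangularNormals, triangularEdges, inner_comb]

theorem linearIndependent_triangularEdges (hs : 0 < s) (hZ : 0 < Z) :
    LinearIndependent ℝ (triangularEdges f x s y Y Z) :=
  linearIndependent_of_dual (inner_triangular_of_ne f) fun k => (inner_triangular_neg f hs hZ k).ne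

theorem linearIndependent_triangularNormals (hs : 0 < s) (hZ : 0 < Z) :
    LinearIndependent ℝ (triangularNormals f x s y Y Z) := by
  refine linearIndependent_of_dual (N := triangularEdges f x s y Y Z) (fun k l hkl => ?_)
    fun k => ?_
  · rw [real_inner_comm]
    exact inner_triangular_of_ne f l k hkl.symm
  · rw [real_inner_comm]
    exact (inner_triangular_neg f hs hZ k).ne

theorem coneOf_triangularEdges (hs : 0 < s) (hZ : 0 < Z) :
    coneOf (triangularEdges f x s y Y Z) = halfspaceCone (triangularNormals f x s y Y Z) :=
  coneOf_eq_halfspaceCone (inner_triangular_of_ne f) (inner_triangular_neg f hs hZ)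

theorem norm_triangularNormals (h1 : x ^ 2 + s ^ 2 = 1) (h2 : y ^ 2 + Y ^ 2 + Z ^ 2 = 1)
    (k : Fin 3) : ‖triangularNormals f x s y Y Z k‖ = 1 := by
  have key : ∀ a b c : ℝ, a ^ 2 + b ^ 2 + c ^ 2 = 1 → ‖comb f a b c‖ = 1 := fun a b c h => by
    rw [← sq_eq_sq₀ (norm_nonneg _) zero_le_one, ← real_inner_self_eq_norm_sq, inner_comb]
    linarith
  fin_cases k
  · exact key _ _ _ (by norm_num)
  · exact key _ _ _ (by linarith)
  · exact key _ _ _ h2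

theorem continuous_triangularEdges {T : Type*} [TopologicalSpace T] {x s y Y Z : T → ℝ}
    (hx : Continuous x) (hs : Continuous s) (hy : Continuous y) (hY : Continuous Y)
    (hZ : Continuous Z) : Continuous fun t => triangularEdges f (x t) (s t) (y t) (Y t) (Z t) := by
  refine continuous_pi fun k => ?_
  fin_cases k <;> simp only [triangularEdges, comb, Fin.zero_eta, Fin.mk_one, Fin.reduceFinMk,
    Matrix.cons_val] <;> fun_prop

end Triangular

/-! ### Congruence classes and the path to the octant. -/

theorem image_coneOf (ρ : E3 ≃ₗᵢ[ℝ] E3) (v : Fin 3 → E3) :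
    ρ '' coneOf v = coneOf fun k => ρ (v k) := by
  ext x
  constructor
  · rintro ⟨_, ⟨t, ht, rfl⟩, rfl⟩
    exact ⟨t, ht, by simp⟩
  · rintro ⟨t, ht, rfl⟩
    exact ⟨_, ⟨t, ht, rfl⟩, by simp⟩

theorem coneOf_comp_perm (v : Fin 3 → E3) (p : Equiv.Perm (Fin 3)) :
    coneOf (fun k => v (p k)) = coneOf v := by
  ext x
  constructor
  · rintro ⟨t, ht, rfl⟩
    refine ⟨fun k => t (p.symm k), fun k => ht _, ?_⟩
    simpa using Equiv.sum_comp p fun k => t (p.symm k) • v k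
  · rintro ⟨t, ht, rfl⟩
    exact ⟨fun k => t (p k), fun k => ht _, (Equiv.sum_comp p fun k => t k • v k).symm⟩

/-- If `g` has the wrong orientation, swapping two of its vectors corrects it without changing the
cone. -/
theorem exists_isRotation_image_coneOf (g : OrthonormalBasis (Fin 3) ℝ E3) :
    ∃ ρ : E3 ≃ₗᵢ[ℝ] E3, IsRotation ρ ∧
      ρ '' coneOf (EuclideanSpace.basisFun (Fin 3) ℝ) = coneOf g := by
  let e := EuclideanSpace.basisFun (Fin 3) ℝ
  have key : ∀ p : Equiv.Perm (Fin 3), (e.equiv g p) '' coneOf e = coneOf g := by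
    intro p
    rw [image_coneOf]
    simp only [OrthonormalBasis.equiv_apply_basis]
    exact coneOf_comp_perm g p
  have hdet : ∀ p : Equiv.Perm (Fin 3),
      LinearMap.det ((e.equiv g p).toLinearEquiv : E3 →ₗ[ℝ] E3) = e.toBasis.det (g ∘ p) := by
    intro p
    have := e.toBasis.det_comp ((e.equiv g p).toLinearEquiv : E3 →ₗ[ℝ] E3) e
    rw [← e.coe_toBasis, e.toBasis.det_self, mul_one, e.coe_toBasis] at this
    rw [← this]
    congr 1
    ext1 k
    simp
  have habs : |LinearMap.det ((e.equiv g (Equiv.refl _)).toLinearEquiv : E3 →ₗ[ℝ] E3)| = 1 := by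
    rw [← LinearMap.normDet_eq_abs_det]
    exact (e.equiv g (Equiv.refl _)).toLinearIsometry.normDet_eq_one
  rcases (abs_eq zero_le_one).1 habs with h | h
  · exact ⟨_, h, key _⟩
  · refine ⟨e.equiv g (Equiv.swap 0 1), ?_, key _⟩
    rw [hdet] at h
    rw [IsRotation, hdet, AlternatingMap.map_swap _ _ (by decide)]
    have h' : e.toBasis.det g = -1 := h
    rw [h', neg_neg]

namespace TrihedralAngle

theorem IsSpecial.of_equiv {A B : TrihedralAngle} (hAB : A ≈ B) (hA : A.IsSpecial) :
    B.IsSpecial := by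
  obtain ⟨σ, hσ, hB⟩ := hAB
  obtain ⟨r, ρ, c, hr, hρ, H⟩ := hA
  refine ⟨r, ρ.trans σ, σ c, hr, hρ.trans hσ, fun x hx => ?_⟩
  have hf : frontier B.carrier = σ '' frontier A.carrier := by
    rw [← hB]
    exact (σ.toHomeomorph.image_frontier A.carrier).symm
  rw [hf]
  exact ⟨_, H x hx, by simp⟩

theorem mk_mem_compl_specialAngles {A : TrihedralAngle} :
    Quotient.mk congruence A ∈ univ \ specialAngles ↔ ¬ A.IsSpecial := by
  simp only [mem_sdiff, mem_univ, true_and, specialAngles, mem_ofPred_eq, not_iff_not]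
  constructor
  · rintro ⟨B, hB, h⟩
    exact hB.of_equiv (Quotient.exact h)
  · exact fun h => ⟨A, h, rfl⟩

theorem continuous_mk_ofFrame :
    Continuous fun v : Frame => Quotient.mk congruence (ofFrame v) :=
  continuous_quotient_mk'.comp continuous_coinduced_rng

/-- The right-angled trihedral angle. -/
noncomputable def octant : TrihedralAngle :=
  ofFrame ⟨EuclideanSpace.basisFun (Fin 3) ℝ,
    (EuclideanSpace.basisFun (Fin 3) ℝ).orthonormal.linearIndependent⟩

/-- Orthogonal unit normals violate the clause `A * B ≤ 9 * p ^ 2`. -/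
theorem not_isSpecial_octant : ¬ octant.IsSpecial := by
  let e := EuclideanSpace.basisFun (Fin 3) ℝ
  let N : Fin 3 → E3 := fun k => -e k
  have hinner : ∀ k l, k ≠ l → ⟪N l, e k⟫ = 0 := fun k l hkl => by
    simp only [N, inner_neg_left, e.orthonormal.2 hkl.symm, neg_zero]
  have hself : ∀ k, ⟪N k, e k⟫ = -1 := fun k => by
    simp only [N, inner_neg_left, real_inner_self_eq_norm_sq, e.orthonormal.1 k, one_pow]
  have hcone : octant.carrier = halfspaceCone N :=
    coneOf_eq_halfspaceCone hinner fun k => by rw [hself]; norm_num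
  have hli : LinearIndependent ℝ N :=
    linearIndependent_of_dual (N := e)
      (fun k l hkl => by rw [real_inner_comm]; exact hinner l k hkl.symm)
      fun k => by rw [real_inner_comm, hself]; norm_num
  intro h
  rw [IsSpecial, hcone] at h
  obtain ⟨i, j, k, hij, -, -, -, hc, -⟩ := isCoveringUnordered_of_admits
    (fun k => by simp only [N, norm_neg, e.orthonormal.1 k]) hli h
  simp only [N, inner_neg_left, inner_neg_right, neg_neg, real_inner_self_eq_norm_sq,
    e.orthonormal.1, e.orthonormal.2 hij] at hc
  norm_num at hc

theorem joinedIn_octant {A : TrihedralAngle} (hA : ¬ A.IsSpecial) :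
    JoinedIn (univ \ specialAngles) (Quotient.mk congruence octant)
      (Quotient.mk congruence A) := by
  obtain ⟨v, hv⟩ := A.exists_frame
  obtain ⟨N, hN, hli, hcone⟩ := exists_unit_normals v
  have hAN : A.carrier = halfspaceCone N := hv.trans hcone
  obtain ⟨f, x, s, y, Y, Z, hs, hZ, h1, h2, hN0, hN1, hN2⟩ :=
    exists_adapted_orthonormalBasis (i := 0) (j := 1) (k := 2) hN hli (by decide) (by decide)
      (by decide)
  have hNt : N = triangularNormals f x s y Y Z := by
    ext1 k
    fin_cases k
    · exact hN0
    · exact hN1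
    · exact hN2
  obtain ⟨z, hz⟩ : ∃ z, z = x * y + s * Y := ⟨_, rfl⟩
  have hsY : s * Y = z - x * y := by linarith
  have hx : x ^ 2 < 1 := by
    have : 0 < s ^ 2 := by positivity
    linarith
  have hD : 1 + 2 * x * y * z - x ^ 2 - y ^ 2 - z ^ 2 = (s * Z) ^ 2 := by
    rw [hz]
    linear_combination (y ^ 2 - 1) * h1 - s ^ 2 * h2
  have hy : y ^ 2 < 1 := by
    have : 0 < Z ^ 2 := by positivity
    nlinarith [sq_nonneg Y]
  have hz' : z ^ 2 < 1 := by
    have : 0 < (s * Z) ^ 2 := by positivity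
    rw [← hD] at this
    have h3 : 0 < (1 - x ^ 2) * (1 - z ^ 2) - (y - x * z) ^ 2 := by linarith
    by_contra! hc
    nlinarith [sq_nonneg (y - x * z), mul_nonneg (sub_nonneg.2 hx.le) (sub_nonneg.2 hc)]
  -- `S`, `Y'`, `Z'` are the Cholesky entries of the Gram matrix with off-diagonal entries `l * x`,
  -- `l * y`, `l * z`.
  let S : ℝ → ℝ := fun l => √(1 - (l * x) ^ 2)
  let D : ℝ → ℝ := fun l =>
    1 + 2 * (l * x) * (l * y) * (l * z) - (l * x) ^ 2 - (l * y) ^ 2 - (l * z) ^ 2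
  let Y' : ℝ → ℝ := fun l => (l * z - l * x * (l * y)) / S l
  let Z' : ℝ → ℝ := fun l => √(D l) / S l
  have hDpos : ∀ l : unitInterval, 0 < D l := fun l =>
    gramDet_smul_pos hx.le hy.le hz'.le (by rw [hD]; positivity) l.2.1 l.2.2
  have hS0 : ∀ l : unitInterval, 0 < 1 - ((l : ℝ) * x) ^ 2 := fun l => by
    have h3 : (l : ℝ) ^ 2 ≤ 1 := pow_le_one₀ l.2.1 l.2.2
    nlinarith [sq_nonneg x]
  have hSpos : ∀ l : unitInterval, 0 < S l := fun l => Real.sqrt_pos.2 (hS0 l)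
  have hSsq : ∀ l : unitInterval, S l ^ 2 = 1 - ((l : ℝ) * x) ^ 2 := fun l => Real.sq_sqrt (hS0 l).le
  have hDsq : ∀ l : unitInterval, √(D l) ^ 2 = D l := fun l => Real.sq_sqrt (hDpos l).le
  have hZpos : ∀ l : unitInterval, 0 < Z' l := fun l => div_pos (Real.sqrt_pos.2 (hDpos l)) (hSpos l)
  have hSY : ∀ l : unitInterval, S l * Y' l = l * z - l * x * (l * y) := fun l =>
    mul_div_cancel₀ _ (hSpos l).ne'
  have hSZ : ∀ l : unitInterval, S l * Z' l = √(D l) := fun l => mul_div_cancel₀ _ (hSpos l).ne'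
  have hn1 : ∀ l : unitInterval, ((l : ℝ) * x) ^ 2 + S l ^ 2 = 1 := fun l => by
    rw [hSsq]; ring
  have hn2 : ∀ l : unitInterval, ((l : ℝ) * y) ^ 2 + Y' l ^ 2 + Z' l ^ 2 = 1 := fun l => by
    have h3 : S l ^ 2 * (((l : ℝ) * y) ^ 2 + Y' l ^ 2 + Z' l ^ 2) = S l ^ 2 * 1 := by
      have : S l ^ 2 * (((l : ℝ) * y) ^ 2 + Y' l ^ 2 + Z' l ^ 2)
          = S l ^ 2 * ((l : ℝ) * y) ^ 2 + (S l * Y' l) ^ 2 + (S l * Z' l) ^ 2 := by ring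
      rw [this, hSY, hSZ, hDsq, hSsq]
      simp only [D]
      ring
    exact mul_left_cancel₀ (pow_pos (hSpos l) 2).ne' h3
  let M : unitInterval → Fin 3 → E3 := fun l => triangularNormals f (l * x) (S l) (l * y) (Y' l) (Z' l)
  let V : unitInterval → Fin 3 → E3 := fun l => triangularEdges f (l * x) (S l) (l * y) (Y' l) (Z' l)
  have hV : ∀ l, LinearIndependent ℝ (V l) := fun l =>
    linearIndependent_triangularEdges f (hSpos l) (hZpos l)
  have hVM : ∀ l, coneOf (V l) = halfspaceCone (M l) := fun l =>
    coneOf_triangularEdges f (hSpos l) (hZpos l)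
  have hMN : ∀ l i j, i ≠ j → ⟪M l i, M l j⟫ = l * ⟪N i, N j⟫ := by
    intro l i j hij
    have h4 := hSY l
    rw [hNt]
    fin_cases i <;> fin_cases j <;> first
      | exact absurd rfl hij
      | (simp only [M, triangularNormals, Fin.zero_eta, Fin.mk_one, Fin.reduceFinMk,
          Matrix.cons_val, inner_comb]; ring_nf; done)
      | (simp only [M, triangularNormals, Fin.mk_one, Fin.reduceFinMk,
          Matrix.cons_val, inner_comb]; linear_combination h4 + (l : ℝ) * hz)
  have hcS : Continuous fun l : unitInterval => S l := by fun_prop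
  have hcD : Continuous fun l : unitInterval => D l := by fun_prop
  have hcY : Continuous fun l : unitInterval => Y' l :=
    Continuous.div (by fun_prop) hcS fun l => (hSpos l).ne'
  have hcZ : Continuous fun l : unitInterval => Z' l :=
    Continuous.div (by fun_prop) hcS fun l => (hSpos l).ne'
  have hcV : Continuous V :=
    continuous_triangularEdges f (by fun_prop) hcS (by fun_prop) hcY hcZ
  let γ : unitInterval → AngleSpace := fun l => Quotient.mk congruence (ofFrame ⟨V l, hV l⟩)
  have hγ : Continuous γ := continuous_mk_ofFrame.comp (hcV.subtype_mk hV)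
  have hsource : γ 0 = Quotient.mk congruence octant := by
    refine Quotient.sound (Setoid.symm ?_)
    -- At `l = 0` the outward normals are the basis `f`, so the edges are its negatives.
    obtain ⟨ρ, hρ, h⟩ := exists_isRotation_image_coneOf (f.map (LinearIsometryEquiv.neg ℝ))
    refine ⟨ρ, hρ, h.trans ?_⟩
    change _ = coneOf (V 0)
    congr 1
    ext1 k
    have s0 : S 0 = 1 := by simp [S]
    have d0 : D 0 = 1 := by simp [D]
    fin_cases k <;> simp [V, triangularEdges, comb, Y', Z', s0, d0]
  have htarget : γ 1 = Quotient.mk congruence A := by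
    have s1 : S 1 = s := by
      simp only [S, one_mul]
      rw [show 1 - x ^ 2 = s ^ 2 by linarith, Real.sqrt_sq hs.le]
    have y1 : Y' 1 = Y := by
      simp only [Y', s1, one_mul, ← hsY]
      field_simp
    have z1 : Z' 1 = Z := by
      simp only [Z', D, s1, one_mul, hD]
      rw [Real.sqrt_sq (by positivity)]
      field_simp
    have : ofFrame ⟨V 1, hV 1⟩ = A := by
      ext1
      rw [hAN]
      change coneOf (V 1) = _
      rw [hVM, hNt]
      simp only [M, Set.Icc.coe_one, s1, y1, z1, one_mul]
    simp only [γ, this]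
  refine ⟨⟨⟨γ, hγ⟩, hsource, htarget⟩, fun l => ?_⟩
  change γ l ∈ _
  rw [mk_mem_compl_specialAngles]
  have hl := not_admits_of_scaled hN hli (norm_triangularNormals f (hn1 l) (hn2 l))
    (linearIndependent_triangularNormals f (hSpos l) (hZpos l)) l.2.1 l.2.2 (hMN l)
    (by rw [← hAN]; exact hA)
  have : (ofFrame ⟨V l, hV l⟩).carrier = halfspaceCone (M l) := hVM l
  rw [IsSpecial, this]
  exact hl

end TrihedralAngle

end OctahedronInscription

theorem mainTheorem4 :
    IsPathConnected (Set.univ \ OctahedronInscription.specialAngles :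
      Set OctahedronInscription.AngleSpace) := by
  refine ⟨_, OctahedronInscription.TrihedralAngle.mk_mem_compl_specialAngles.2
    OctahedronInscription.TrihedralAngle.not_isSpecial_octant, fun {q} => ?_⟩
  induction q using Quotient.inductionOn with
  | h A =>
    intro hA
    exact OctahedronInscription.TrihedralAngle.joinedIn_octant
      (OctahedronInscription.TrihedralAngle.mk_mem_compl_specialAngles.1 hA)
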